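/- **Conventions.** $H$ and $Z$ are the Hadamard and Pauli-$Z$ gates, $R_Z(\theta)=e^{-i\theta Z/2}$, and $CZ$ is the controlled-$Z$ gate. Given a finite graph $G$ on $n$ qubits and $\theta\in\mathbb R^n$, the *instantaneously-deep QNN* (IDQNN) with geometry $G$ and parameters $\theta$ maps an input $x\in\{0,1\}^n$ to a random $y\in\{0,1\}^n$ as follows: prepare qubit $v$ in $|+\rangle$ if $x_v=0$ and in $|0\rangle$ if $x_v=1$; apply $R_Z(\theta_v)$ to every qubit $v$; apply $CZ$ on every edge of $G$; measure all qubits in the Pauli-$X$ basis, giving $y$. A *sliced lattice* of size $n_1\times n_2\times\cdots\times n_D$ is a graph obtained from the $D$-dimensional Euclidean lattice of that size (sites at $\ell^1$-distance $1$ are adjacent) by deleting some edges whose two ends have the same first coordinate $i_1$. **(A) Shallow-to-deep equivalence.** Let $D\ge2$, $n_1\ge 1$, let $G$ be a sliced lattice of size $n_1\times\cdots\times n_D$, let $\theta$ be real parameters and $x$ an input bitstring. Then the output $y$ of the IDQNN has exactly the distribution produced by the following depth-$n_1$ process on qubits labelled by $s=(i_2,\dots,i_D)$. Start qubit $s$ in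 $|+\rangle$ if $x_{(1,s)}=0$ and in $|0\rangle$ if $x_{(1,s)}=1$. For $i_1=1,\dots,n_1$ in turn: apply $R_Z(\theta_{(i_1,s)})$ to every qubit $s$ and $CZ$ on all edges of $G$ inside slice $i_1$; then, if $i_1<n_1$, for every $s$, * if $x_{(i_1+1,s)}=0$, draw $y_{(i_1,s)}$ as a uniformly random bit, apply $Z$ to qubit $s$ if $y_{(i_1,s)}=1$, and then apply $H$ to qubit $s$; * if $x_{(i_1+1,s)}=1$, measure qubit $s$ in the $X$ basis, let $y_{(i_1,s)}$ be the outcome, and reset qubit $s$ to $|0\rangle$; if $i_1=n_1$, measure all qubits in the $X$ basis, giving the bits $y_{(n_1,s)}$. **(B) IDQNN for any deep circuit.** There is a function $r=r(m,\ell,\varepsilon)\ge1$, bounded by a polynomial in $m$, $\ell$ and $\max(0,\log(1/\varepsilon))$, such that for all $\varepsilon>0$ and all $m$-qubit circuits $C$ consisting of arbitrary one-qubit gates and $\ell$ arbitrary two-qubit gates (on any pairs of qubits) the following holds. A *1D circuit $D$ with $r$ rounds* on $m$ qubits in a line consists of $r$ rounds, each being a layer of $H$ on all qubits, then a layer of $R_Z$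 gates with independent angles on the qubits, then $CZ$ gates on some nearest-neighbour pairs. For $y'\in\{0,1\}^{(r-1)\times m}$, $D(y')$ is the circuit $D$ in which a $Z$ gate is applied to qubit $i$ at the end of round $j$ whenever $y'_{j,i}=1$ ($1\le j\le r-1$, $1\le i\le m$); thus $D(0)=D$. 1. There is a 1D circuit $D$ with $r$ rounds such that the unitary channels of $D(0)$ and $C$ are within $\varepsilon$ in diamond distance. 2. For every such $D$ there is an IDQNN on $n=m\times r$ qubits, whose geometry $G$ is a sliced 2D lattice of size $r\times m$ (first coordinate: round), such that * for every input, its pre-measurement state including the basis change for the $X$-measurement is prepared from $|0^n\rangle$ by a circuit of depth at most $7$ of one- and two-qubit gates; * on input $x=0^n$ its output $y$ is distributed as follows: the first $(r-1)m$ bits are a uniformly random $y'\in\{0,1\}^{(r-1)\times m}$, and, given $y'$, the last $m$ bits are the outcome of measuring $D(y')|0^m\rangle$ in the standard basis. -/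

import Mathlib

open Matrix

noncomputable section

namespace IDQNN

/-! Qubits are indexed by a finite type `Q`, computational-basis labels are functions `Q → Fin 2`,
state vectors are functions on the labels and operators are matrices indexed by the labels. -/

/-- Bitstrings (computational-basis labels) of a register with qubits `Q`. -/
abbrev Bits (Q : Type*) := Q → Fin 2

/-- Operators on the register with qubits `Q`. -/
abbrev Op (Q : Type*) := Matrix (Bits Q) (Bits Q) ℂ

/-- The Hadamard gate. -/
def hGate : Matrix (Fin 2) (Fin 2) ℂ :=
  ((Real.sqrt 2 : ℝ) : ℂ)⁻¹ • !![1, 1; 1, -1]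

/-- The Pauli `Z` gate. -/
def zGate : Matrix (Fin 2) (Fin 2) ℂ := !![1, 0; 0, -1]

/-- The rotation `R_Z(θ) = exp (-i θ Z / 2)`. -/
def rzGate (θ : ℝ) : Matrix (Fin 2) (Fin 2) ℂ :=
  !![Complex.exp (-(Complex.I * θ / 2)), 0; 0, Complex.exp (Complex.I * θ / 2)]

/-- The tensor product of one-qubit operators `U q`, one on each qubit `q`. -/
def layer {Q : Type*} [Fintype Q] (U : Q → Matrix (Fin 2) (Fin 2) ℂ) : Op Q :=
  Matrix.of fun a b => ∏ q, U q (a q) (b q)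

open Classical in
/-- The product of the (commuting, diagonal) `CZ` gates on all edges of `G`: each edge contributes
a factor `-1` on the basis labels in which both of its end points carry a `1`. -/
def czLayer {Q : Type*} [Fintype Q] [DecidableEq Q] (G : SimpleGraph Q) : Op Q :=
  Matrix.diagonal fun b => ∏ e ∈ G.edgeFinset, if ∀ u ∈ e, b u = 1 then -1 else 1

/-- The basis state `|0…0⟩`. -/
def ket0 {Q : Type*} [Fintype Q] : Bits Q → ℂ := fun b => if b = 0 then 1 else 0

/-- The product state selected by `x`: qubit `q` is in state `|+⟩` if `x q = 0`, in state `|0⟩`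
if `x q = 1`. -/
def inputState {Q : Type*} [Fintype Q] (x : Bits Q) : Bits Q → ℂ := fun b =>
  ∏ q, if x q = 0 then ((Real.sqrt 2 : ℝ) : ℂ)⁻¹ else if b q = 0 then 1 else 0

/-- The operator product `M (k-1) * ⋯ * M 1 * M 0`: the operator `M 0` acts first. -/
def timeOrdered {Q : Type*} [Fintype Q] [DecidableEq Q] {k : ℕ} (M : Fin k → Op Q) : Op Q :=
  (List.ofFn M).reverse.prod

/-! ### Instantaneously-deep quantum neural networks -/

/-- The final state of the instantaneously-deep QNN with geometry `G`, parameters `θ` and input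
`x`: prepare the product state of `x`, rotate each qubit `v` by `R_Z (θ v)`, apply `CZ` on all
edges of `G`. The closing Hadamard layer turns the measurement in the Pauli-`X` basis into a
measurement in the computational basis. -/
def qnnState {V : Type*} [Fintype V] [DecidableEq V] (G : SimpleGraph V) (θ : V → ℝ) (x : Bits V) : Bits V → ℂ :=
  (layer (fun _ => hGate) * czLayer G * layer (fun v => rzGate (θ v))) *ᵥ inputState x

/-- The probability that the instantaneously-deep QNN outputs `y` on input `x`. -/
def qnnProb {V : Type*} [Fintype V] [DecidableEq V] (G : SimpleGraph V) (θ : V → ℝ) (x y : Bits V) : ℝ :=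
  ‖qnnState G θ x y‖ ^ 2

/-! ### Lattices -/

/-- The Euclidean lattice of size `n 0 × n 1 × ⋯`: sites at `ℓ¹`-distance `1` are adjacent. -/
def latticeGraph {d : ℕ} (n : Fin d → ℕ) : SimpleGraph ((j : Fin d) → Fin (n j)) where
  Adj u v := ∑ j, |((u j : ℕ) : ℤ) - ((v j : ℕ) : ℤ)| = 1
  symm := ⟨by intro u v h; simpa only [abs_sub_comm] using h⟩
  loopless := ⟨by intro u h; simp at h⟩

/-- `G` is the lattice with first ("time") coordinate in `Fin r` and slices `L`, from which some
edges inside the slices may have been removed: every edge of `G` is an edge of the full lattice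
`pathGraph r □ L`, and all edges along the time direction are present. -/
def IsSlicedLattice {r : ℕ} {S : Type*} (L : SimpleGraph S) (G : SimpleGraph (Fin r × S)) : Prop :=
  G ≤ SimpleGraph.boxProd (SimpleGraph.pathGraph r) L ∧
    ∀ (j j' : Fin r) (s : S), (SimpleGraph.pathGraph r).Adj j j' → G.Adj (j, s) (j', s)

/-! ### The deep process simulated by a sliced lattice -/

/-- The operations of time step `j`: the rotations `R_Z (θ (j, s))`, then `CZ` on the edges of the
`j`-th slice of `G`. -/
def sliceOp {r : ℕ} {S : Type*} [Fintype S] [DecidableEq S] (G : SimpleGraph (Fin r × S)) (θ : Fin r × S → ℝ)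
    (j : Fin r) : Op S :=
  czLayer (G.comap fun s => (j, s)) * layer fun s => rzGate (θ (j, s))

/-- The one-qubit Kraus operator for the outcome `y` of the step leading to a slice with input
bit `x`.
If `x = 0`: a uniformly random bit `y` is drawn (weight `1 / 2`, amplitude `1 / √2`), `Z` is
applied if `y = 1`, and then `H` is applied.
If `x = 1`: the qubit is measured in the Pauli-`X` basis with outcome `y` and reset to `|0⟩`,
that is, the operator is `|0⟩⟨y| H`. -/
def transfer (x y : Fin 2) : Matrix (Fin 2) (Fin 2) ℂ :=
  if x = 0 then ((Real.sqrt 2 : ℝ) : ℂ)⁻¹ • (hGate * zGate ^ (y : ℕ))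
  else Matrix.of fun a b => if a = 0 then hGate y b else 0

/-- The joint probability of the record `y` in the depth-`(k + 1)` process on the qubits `S` :
start in the product state of the first slice of `x`; at time `j` apply `sliceOp G θ j`; for
`j < k` then act on every qubit `s` by the random `Z` and the `H`, or the measurement and reset,
described in `transfer`, producing the bit `y (j, s)`; at the last time measure all qubits in the
Pauli-`X` basis, producing the bits `y (k, s)`. It is the squared modulus of the corresponding
amplitude of the unnormalized post-measurement state. -/
def deepProb {k : ℕ} {S : Type*} [Fintype S] [DecidableEq S] (G : SimpleGraph (Fin (k + 1) × S))
    (θ : Fin (k + 1) × S → ℝ) (x y : Bits (Fin (k + 1) × S)) : ℝ :=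
  ‖((layer (fun _ => hGate) * sliceOp G θ (Fin.last k) *
      timeOrdered fun j : Fin k =>
        layer (fun s => transfer (x (j.succ, s)) (y (j.castSucc, s))) * sliceOp G θ j.castSucc)
    *ᵥ inputState fun s => x (0, s)) fun s => y (Fin.last k, s)‖ ^ 2

/-! ### General quantum circuits -/

/-- A gate: an arbitrary one-qubit unitary on a qubit, or an arbitrary two-qubit unitary on an
ordered pair of distinct qubits. -/
inductive Gate (Q : Type*)
  | one (q : Q) (U : Matrix.unitaryGroup (Fin 2) ℂ)
  | two (p q : Q) (hpq : p ≠ q) (U : Matrix.unitaryGroup (Fin 2 × Fin 2) ℂ)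

namespace Gate

open Classical in
/-- The operator of a gate on the whole register: identity on the qubits it does not touch. -/
def op {Q : Type*} : Gate Q → Op Q
  | one q U => Matrix.of fun a b =>
      if ∀ s, s ≠ q → a s = b s then U.1 (a q) (b q) else 0
  | two p q _ U => Matrix.of fun a b =>
      if ∀ s, s ≠ p → s ≠ q → a s = b s then U.1 (a p, a q) (b p, b q) else 0

/-- The qubits a gate acts on. -/
def support {Q : Type*} : Gate Q → Set Q
  | one q _ => {q}
  | two p q _ _ => {p, q}

/-- Whether a gate is a two-qubit gate. -/
def isTwo {Q : Type*} : Gate Q → Bool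
  | one _ _ => false
  | two _ _ _ _ => true

end Gate

/-- A quantum circuit: a finite list of gates, the head of the list acting first. -/
abbrev Circuit (Q : Type*) := List (Gate Q)

/-- The unitary implemented by a circuit. -/
def circuitOp {Q : Type*} [Fintype Q] [DecidableEq Q] (c : Circuit Q) : Op Q := (c.map Gate.op).reverse.prod

/-- The number of two-qubit gates of a circuit. -/
def twoQubitCount {Q : Type*} (c : Circuit Q) : ℕ := c.countP Gate.isTwo

/-- The circuit has depth at most `d`: it is a sequence of at most `d` layers, the gates of each
layer acting on pairwise disjoint sets of qubits. -/
def HasDepthAtMost {Q : Type*} (c : Circuit Q) (d : ℕ) : Prop :=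
  ∃ layers : List (List (Gate Q)), layers.flatten = c ∧ layers.length ≤ d ∧
    ∀ l ∈ layers, l.Pairwise fun g g' => Disjoint g.support g'.support

/-! ### Diamond distance -/

/-- The trace norm `Tr |A|`: the sum of the singular values of `A`. -/
def traceNorm {ι : Type*} [Fintype ι] [DecidableEq ι] (A : Matrix ι ι ℂ) : ℝ :=
  ∑ i, Real.sqrt ((Matrix.isHermitian_conjTranspose_mul_self A).eigenvalues i)

/-- The channel `ρ ↦ U ρ U†`. -/
def conjChannel {ι : Type*} [Fintype ι] (U : Matrix ι ι ℂ) : Matrix ι ι ℂ → Matrix ι ι ℂ :=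
  fun ρ => U * ρ * Uᴴ

/-- The extension `E ⊗ id` of a linear map `E` on matrices to a system with an ancilla `κ`: it
acts by `E` on each of the blocks given by fixing the two ancilla indices. -/
def ampliate {ι κ : Type*} (E : Matrix ι ι ℂ → Matrix ι ι ℂ) :
    Matrix (ι × κ) (ι × κ) ℂ → Matrix (ι × κ) (ι × κ) ℂ :=
  fun ρ => Matrix.of fun a b => E (Matrix.of fun i j => ρ (i, a.2) (j, b.2)) a.1 b.1

open scoped ComplexOrder in
/-- The diamond distance: the supremum over all finite-dimensional ancillas and all density
matrices `ρ` of the trace norm of `(E ⊗ id - F ⊗ id) ρ`. -/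
def diamondDist {ι : Type*} [Fintype ι] [DecidableEq ι] (E F : Matrix ι ι ℂ → Matrix ι ι ℂ) :
    ENNReal :=
  ⨆ (n : ℕ) (ρ : Matrix (ι × Fin n) (ι × Fin n) ℂ) (_ : ρ.PosSemidef) (_ : ρ.trace = 1),
    ENNReal.ofReal (traceNorm (ampliate E ρ - ampliate F ρ))

/-! ### The family of deep one-dimensional circuits -/

/-- A 1D circuit on `m` qubits with `r` rounds. Each round is a Hadamard layer, then a layer of
`R_Z` rotations with independent angles, then `CZ` gates on some nearest-neighbour pairs. -/
structure LayeredCircuit (m r : ℕ) where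
  angle : Fin r → Fin m → ℝ
  cz : Fin r → SimpleGraph (Fin m)
  cz_le : ∀ j, cz j ≤ SimpleGraph.pathGraph m

namespace LayeredCircuit

/-- The unitary of the `j`-th round. -/
def round {m r : ℕ} (D : LayeredCircuit m r) (j : Fin r) : Op (Fin m) :=
  czLayer (D.cz j) * layer (fun i => rzGate (D.angle j i)) * layer fun _ => hGate

/-- The member `D(y')` of the family: the circuit `D` in which, at the end of each round `j` but
the last, a `Z` gate is applied to every qubit `i` with `y' (j, i) = 1`. Its member at `y' = 0`
is the circuit `D` itself. -/
def member {m k : ℕ} (D : LayeredCircuit m (k + 1)) (y' : Bits (Fin k × Fin m)) : Op (Fin m) :=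
  D.round (Fin.last k) *
    timeOrdered fun j : Fin k =>
      layer (fun i => zGate ^ (y' (j, i) : ℕ)) * D.round j.castSucc

/-- The probability of the outcome `z` when `D(y')|0^m⟩` is measured in the standard basis. -/
def memberProb {m k : ℕ} (D : LayeredCircuit m (k + 1)) (y' : Bits (Fin k × Fin m))
    (z : Bits (Fin m)) : ℝ :=
  ‖(D.member y' *ᵥ ket0) z‖ ^ 2

end LayeredCircuit

end IDQNN

end

open IDQNN

namespace IDQNN

/-! ### Layers of one-qubit operators and time-ordered products -/

section Layers

variable {Q : Type*} [Fintype Q]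

/-! Part (A) holds already for amplitudes. Expand both sides over computational-basis labels: a
label of the whole lattice is the same thing as a path of labels of the deep process, one per time
step. The summands agree because the `CZ` phase of a sliced lattice splits into slice phases and one
sign per time edge (`czPhase_slicedLattice`), and the measured qubit, the time edge and the freshly
prepared qubit multiply to one Kraus operator (`transfer_apply`). This gives `qnnState_eq_deepAmp`.

For the existence of a 1D circuit, the compilation is exact up to a global phase, so the diamond
distance is zero and the number of rounds does not involve the precision. A two-qubit unitary is a
product of four generalised Householder reflections, each a conjugate of a controlled phase, hence a
product of 104 `CZ` gates and local unitaries (`unitary_mem_elementary_pow`). Swaps carry `CZ` to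
distant qubits (`embed_czGate_mem_of_lt`). Euler angles put any layer of one-qubit gates into four
rounds (`layer_mem`). One-qubit gates between two-qubit gates merge into a single layer, so only the
two-qubit gates are charged (`exists_circuitOp_eq_mul_layer`).

For the sampling statement, apply (A) to the all-zero input. The process starts with Hadamards on
`|0…0⟩` and each of its `k` steps ends with Hadamards; regrouping these with the slice that follows
reproduces the first `k` rounds of `D(y')`. One further Hadamard layer should come before a
standard-basis measurement, the diagonal gates of the last round being invisible to it, but the
process supplies two: the last transfer and the change to the `X` basis. With `S = R_Z(π/2)`, the
identity `S H S H S ∝ H` repairs this: one `S` is the last slice, another is absorbed into the slice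
before it, and the third is an invisible phase (`qnnProb_sampling`).

The depth bound comes from a proper edge colouring of the 2D lattice with four colours. -/

theorem layer_apply (U : Q → Matrix (Fin 2) (Fin 2) ℂ) (a b : Bits Q) :
    layer U a b = ∏ q, U q (a q) (b q) := rfl

theorem layer_mul [DecidableEq Q] (U V : Q → Matrix (Fin 2) (Fin 2) ℂ) :
    layer U * layer V = layer fun q => U q * V q := by
  ext a b
  simp only [Matrix.mul_apply, layer_apply, ← Finset.prod_mul_distrib]
  rw [Finset.prod_univ_sum, Fintype.piFinset_univ]

theorem layer_smul (c : Q → ℂ) (U : Q → Matrix (Fin 2) (Fin 2) ℂ) :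
    (layer fun q => c q • U q) = (∏ q, c q) • layer U := by
  ext a b
  simp [layer_apply, Finset.prod_mul_distrib]

theorem layer_diagonal [DecidableEq Q] (d : Q → Fin 2 → ℂ) :
    (layer fun q => Matrix.diagonal (d q)) = Matrix.diagonal fun b => ∏ q, d q (b q) := by
  ext a b
  rw [layer_apply, Matrix.diagonal_apply]
  split_ifs with h
  · subst h; simp
  · obtain ⟨q, hq⟩ := Function.ne_iff.mp h
    exact Finset.prod_eq_zero (Finset.mem_univ q) (Matrix.diagonal_apply_ne _ hq)

theorem layer_one [DecidableEq Q] : (layer fun _ : Q => (1 : Matrix (Fin 2) (Fin 2) ℂ)) = 1 := by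
  simpa [← Matrix.diagonal_one] using layer_diagonal fun (_ : Q) (_ : Fin 2) => (1 : ℂ)

theorem layer_mulVec_prod [DecidableEq Q] (U : Q → Matrix (Fin 2) (Fin 2) ℂ)
    (v : Q → Fin 2 → ℂ) :
    (layer U *ᵥ fun b => ∏ q, v q (b q)) = fun b => ∏ q, (U q *ᵥ v q) (b q) := by
  ext a
  simp only [Matrix.mulVec, dotProduct, layer_apply, ← Finset.prod_mul_distrib]
  rw [Finset.prod_univ_sum, Fintype.piFinset_univ]

/-- The diagonal entries of `R_Z(θ)`. -/
noncomputable def rzDiag (θ : ℝ) (b : Fin 2) : ℂ :=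
  if b = 0 then Complex.exp (-(Complex.I * θ / 2)) else Complex.exp (Complex.I * θ / 2)

theorem rzGate_eq_diagonal (θ : ℝ) : rzGate θ = Matrix.diagonal (rzDiag θ) := by
  ext a b
  fin_cases a <;> fin_cases b <;> simp [rzGate, rzDiag]

theorem layer_rz [DecidableEq Q] (θ : Q → ℝ) :
    (layer fun q => rzGate (θ q)) = Matrix.diagonal fun b => ∏ q, rzDiag (θ q) (b q) := by
  simp only [rzGate_eq_diagonal, layer_diagonal]

theorem timeOrdered_zero [DecidableEq Q] (M : Fin 0 → Op Q) : timeOrdered M = 1 := by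
  simp [timeOrdered]

theorem timeOrdered_succ [DecidableEq Q] {k : ℕ} (M : Fin (k + 1) → Op Q) :
    timeOrdered M = timeOrdered (fun j => M j.succ) * M 0 := by
  simp [timeOrdered, List.ofFn_succ]

theorem timeOrdered_succ_last [DecidableEq Q] {k : ℕ} (M : Fin (k + 1) → Op Q) :
    timeOrdered M = M (Fin.last k) * timeOrdered fun j => M j.castSucc := by
  simp [timeOrdered, List.ofFn_succ_last, -List.ofFn_succ]

/-- A matrix element of a time-ordered product is a sum over all paths of basis labels. -/
theorem dotProduct_timeOrdered_mulVec [DecidableEq Q] {k : ℕ} (M : Fin k → Op Q)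
    (u v : Bits Q → ℂ) :
    u ⬝ᵥ (timeOrdered M *ᵥ v) = ∑ β : Fin (k + 1) → Bits Q,
      u (β (Fin.last k)) * (∏ j, M j (β j.succ) (β j.castSucc)) * v (β 0) := by
  induction k generalizing v with
  | zero =>
    rw [timeOrdered_zero, Matrix.one_mulVec, dotProduct]
    refine Fintype.sum_equiv (Equiv.funUnique (Fin 1) (Bits Q)).symm _ _ fun b => ?_
    simp
  | succ k ih =>
    rw [timeOrdered_succ, ← Matrix.mulVec_mulVec, ih,
      ← (Fin.consEquiv fun _ : Fin (k + 2) => Bits Q).sum_comp, Fintype.sum_prod_type,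
      Finset.sum_comm]
    refine Finset.sum_congr rfl fun β _ => ?_
    rw [Matrix.mulVec, dotProduct, Finset.mul_sum]
    refine Finset.sum_congr rfl fun c _ => ?_
    rw [Fin.prod_univ_succ]
    simp only [Fin.consEquiv, Equiv.coe_fn_mk, ← Fin.succ_last, Fin.cons_succ, Fin.castSucc_zero,
      Fin.cons_zero, ← Fin.succ_castSucc]
    ring

end Layers

/-! ### The shallow-to-deep equivalence -/

section ShallowToDeep

/-- The amplitude factor of one qubit in the product state selected by the input bit `x`. -/
noncomputable def inputAmp (x b : Fin 2) : ℂ :=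
  if x = 0 then ((Real.sqrt 2 : ℝ) : ℂ)⁻¹ else if b = 0 then 1 else 0

/-- The phase of a `CZ` gate. -/
def czSign (a b : Fin 2) : ℂ := if a = 1 ∧ b = 1 then -1 else 1

/-- This is the local core of (A). For `x = 0` the `CZ` signs divided by `√2` form the matrix of
`H`, and the sign `(-1)^(y b)` of the measured qubit is `Z^y`. For `x = 1` the new qubit is `|0⟩`,
so the `CZ` is trivial and only measurement and reset remain. -/
theorem transfer_apply (x y a b : Fin 2) :
    transfer x y a b = hGate y b * czSign b a * inputAmp x a := by
  fin_cases x <;> fin_cases y <;> fin_cases a <;> fin_cases b <;>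
    simp [transfer, hGate, zGate, czSign, inputAmp]

open Classical in
/-- The phase that the `CZ` gates on the edges of `G` give to the basis label `b`. -/
noncomputable def czPhase {Q : Type*} [Fintype Q] [DecidableEq Q] (G : SimpleGraph Q) (b : Bits Q) : ℂ :=
  ∏ e ∈ G.edgeFinset, if ∀ u ∈ e, b u = 1 then -1 else 1

theorem czLayer_eq_diagonal {Q : Type*} [Fintype Q] [DecidableEq Q] (G : SimpleGraph Q) :
    czLayer G = Matrix.diagonal (czPhase G) := rfl

theorem czPhase_slicedLattice {k : ℕ} {S : Type*} [Fintype S] [DecidableEq S] {L : SimpleGraph S}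
    {G : SimpleGraph (Fin (k + 1) × S)} (hG : IsSlicedLattice L G) (b : Bits (Fin (k + 1) × S)) :
    czPhase G b = (∏ j, czPhase (G.comap fun s => (j, s)) fun s => b (j, s)) *
      ∏ j : Fin k, ∏ s, czSign (b (j.castSucc, s)) (b (j.succ, s)) := by
  classical
  have hinj (j : Fin (k + 1)) : Function.Injective (fun s : S => (j, s)) :=
    fun _ _ h => (Prod.mk.inj h).2
  -- Every edge lies inside one slice or joins consecutive copies of one site, and all edges of the
  -- second kind are present; the rest of the proof checks that these families are disjoint.
  have hE : G.edgeFinset =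
      (Finset.univ.biUnion fun j => (G.comap fun s => (j, s)).edgeFinset.image
        (Sym2.map fun s => (j, s))) ∪
      (Finset.univ : Finset (Fin k × S)).image
        fun p => s((p.1.castSucc, p.2), (p.1.succ, p.2)) := by
    ext e
    induction e using Sym2.ind with
    | _ u v =>
    obtain ⟨i, s⟩ := u
    obtain ⟨j, t⟩ := v
    simp only [SimpleGraph.mem_edgeFinset, SimpleGraph.mem_edgeSet, Finset.mem_union,
      Finset.mem_biUnion, Finset.mem_univ, true_and, Finset.mem_image, Prod.exists]
    constructor
    · intro h
      rcases hG.1 h with ⟨h1, h2⟩ | ⟨h1, h2⟩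
      · right
        simp only at h1 h2
        subst h2
        rcases SimpleGraph.pathGraph_adj.mp h1 with h1 | h1
        · refine ⟨⟨i, by omega⟩, s, ?_⟩
          have : (⟨i, by omega⟩ : Fin k).succ = j := Fin.ext h1
          rw [this]; rfl
        · refine ⟨⟨j, by omega⟩, s, ?_⟩
          have : (⟨j, by omega⟩ : Fin k).succ = i := Fin.ext h1
          rw [this, Sym2.eq_swap]; rfl
      · left
        simp only at h2
        subst h2
        exact ⟨i, s(s, t), by simpa using h, rfl⟩
    · rintro (⟨l, e, he, h⟩ | ⟨l, s', h⟩)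
      · rw [← SimpleGraph.mem_edgeSet, ← h]
        induction e using Sym2.ind with
        | _ u v => simpa using he
      · rw [← SimpleGraph.mem_edgeSet, ← h, SimpleGraph.mem_edgeSet]
        exact hG.2 _ _ _ (SimpleGraph.pathGraph_adj.mpr (Or.inl (by simp)))
  have hmap (j : Fin (k + 1)) : Function.Injective (Sym2.map fun s : S => (j, s)) :=
    Sym2.map.injective (hinj j)
  unfold czPhase
  rw [show (SimpleGraph.edgeFinset (V := Fin (k + 1) × S) G) = _ from hE,
    Finset.prod_union, Finset.prod_biUnion]
  · congr 1
    · refine Finset.prod_congr rfl fun j _ => ?_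
      rw [Finset.prod_image fun _ _ _ _ h => hmap j h]
      refine Finset.prod_congr rfl fun e _ => ?_
      simp [Sym2.mem_map]
    · rw [Finset.prod_image, ← Finset.univ_product_univ, Finset.prod_product]
      · refine Finset.prod_congr rfl fun j _ => Finset.prod_congr rfl fun s _ => ?_
        simp [czSign, Sym2.mem_iff]
      · rintro ⟨j, s⟩ _ ⟨j', s'⟩ _ h
        simp only [Sym2.eq_iff, Prod.mk.injEq, Fin.ext_iff, Fin.val_castSucc, Fin.val_succ] at h
        rcases h with ⟨⟨h1, h2⟩, _⟩ | ⟨⟨h1, h2⟩, h3, h4⟩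
        · exact Prod.ext (Fin.ext h1) h2
        · omega
  · intro i _ j _ hij
    rw [Function.onFun, Finset.disjoint_left]
    intro e h1 h2
    obtain ⟨e1, -, rfl⟩ := Finset.mem_image.mp h1
    obtain ⟨e2, -, h⟩ := Finset.mem_image.mp h2
    induction e1 using Sym2.ind with
    | _ u v =>
    induction e2 using Sym2.ind with
    | _ u' v' =>
    simp only [Sym2.map_mk, Sym2.eq_iff, Prod.mk.injEq] at h
    rcases h with ⟨⟨h, -⟩, -⟩ | ⟨⟨h, -⟩, -⟩ <;> exact hij h.symm
  · rw [Finset.disjoint_left]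
    intro e h1 h2
    obtain ⟨j, -, h1⟩ := Finset.mem_biUnion.mp h1
    obtain ⟨e1, -, rfl⟩ := Finset.mem_image.mp h1
    obtain ⟨⟨l, s⟩, -, h⟩ := Finset.mem_image.mp h2
    induction e1 using Sym2.ind with
    | _ u v =>
    simp only [Sym2.map_mk, Sym2.eq_iff, Prod.mk.injEq, Fin.ext_iff, Fin.val_castSucc,
      Fin.val_succ] at h
    omega

theorem layer_mulVec_apply {Q : Type*} [Fintype Q] [DecidableEq Q] (U : Q → Matrix (Fin 2) (Fin 2) ℂ)
    (v : Bits Q → ℂ) (a : Bits Q) :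
    (layer U *ᵥ v) a = ∑ b, (∏ q, U q (a q) (b q)) * v b := rfl

/-- The amplitude of the deep process with record `y`. -/
noncomputable def deepAmp {k : ℕ} {S : Type*} [Fintype S] [DecidableEq S] (G : SimpleGraph (Fin (k + 1) × S))
    (θ : Fin (k + 1) × S → ℝ) (x y : Bits (Fin (k + 1) × S)) : ℂ :=
  ((layer (fun _ => hGate) * sliceOp G θ (Fin.last k) *
      timeOrdered fun j : Fin k =>
        layer (fun s => transfer (x (j.succ, s)) (y (j.castSucc, s))) * sliceOp G θ j.castSucc)
    *ᵥ inputState fun s => x (0, s)) fun s => y (Fin.last k, s)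

/-- Rotations and `CZ` layers are diagonal, so the sum over paths for the deep process has one term
per lattice label, and the two sums match term by term. -/
theorem qnnState_eq_deepAmp {k : ℕ} {S : Type*} [Fintype S] [DecidableEq S] {L : SimpleGraph S}
    {G : SimpleGraph (Fin (k + 1) × S)} (hG : IsSlicedLattice L G)
    (θ : Fin (k + 1) × S → ℝ) (x y : Bits (Fin (k + 1) × S)) :
    qnnState G θ x y = deepAmp G θ x y := by
  have hslice (j : Fin (k + 1)) : sliceOp G θ j = Matrix.diagonal fun b : Bits S =>
      czPhase (G.comap fun s => (j, s)) b * ∏ s, rzDiag (θ (j, s)) (b s) := by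
    rw [sliceOp, layer_rz, czLayer_eq_diagonal, Matrix.diagonal_mul_diagonal]
  have hdeep : deepAmp G θ x y = ((layer (fun _ => hGate) * sliceOp G θ (Fin.last k) : Op S)
      fun s => y (Fin.last k, s)) ⬝ᵥ ((timeOrdered fun j : Fin k =>
        layer (fun s => transfer (x (j.succ, s)) (y (j.castSucc, s))) * sliceOp G θ j.castSucc)
    *ᵥ inputState fun s => x (0, s)) := by
    rw [deepAmp, ← Matrix.mulVec_mulVec]; rfl
  rw [hdeep, dotProduct_timeOrdered_mulVec, qnnState, layer_rz, czLayer_eq_diagonal,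
    Matrix.mul_assoc, Matrix.diagonal_mul_diagonal, ← Matrix.mulVec_mulVec, layer_mulVec_apply]
  refine Fintype.sum_equiv (Equiv.curry _ _ _) _ _ fun b => ?_
  simp only [hslice, Matrix.mulVec_diagonal, Matrix.mul_diagonal, layer_apply, Equiv.curry_apply,
    transfer_apply, Finset.prod_mul_distrib]
  rw [czPhase_slicedLattice hG, inputState, inputState]
  simp only [← Finset.univ_product_univ, Finset.prod_product]
  -- The final measurement and final slice lie outside the `k` steps, so their factors are split off
  -- at the last index; the initial state accounts for the input factor at index `0`.
  rw [Fin.prod_univ_castSucc (fun j => ∏ s, hGate (y (j, s)) (b (j, s))),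
    Fin.prod_univ_castSucc (fun j => ∏ s, rzDiag (θ (j, s)) (b (j, s))),
    Fin.prod_univ_castSucc (fun j => czPhase (G.comap fun s => (j, s)) fun s => b (j, s)),
    Fin.prod_univ_succ (n := k)]
  have hcurry (j : Fin (k + 1)) : Function.curry b j = fun s => b (j, s) := rfl
  simp only [hcurry, inputAmp]
  ring

theorem qnnProb_eq_deepProb {k : ℕ} {S : Type*} [Fintype S] [DecidableEq S] {L : SimpleGraph S}
    {G : SimpleGraph (Fin (k + 1) × S)} (hG : IsSlicedLattice L G)
    (θ : Fin (k + 1) × S → ℝ) (x y : Bits (Fin (k + 1) × S)) :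
    qnnProb G θ x y = deepProb G θ x y := by
  rw [qnnProb, qnnState_eq_deepAmp hG]; rfl

end ShallowToDeep


/-! ### Generalised Householder reflections -/

section Reflections

open scoped Pointwise

variable {ι : Type*} [Fintype ι] [DecidableEq ι]

/-- The operator `1 + μ |w⟩⟨w|`. -/
def reflection (μ : ℂ) (w : ι → ℂ) : Matrix ι ι ℂ := 1 + μ • Matrix.vecMulVec w (star w)

/-- The condition that `1 + μ |w⟩⟨w|` is unitary. -/
def IsReflecting (μ : ℂ) (w : ι → ℂ) : Prop := μ + star μ + μ * star μ * (star w ⬝ᵥ w) = 0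

theorem conjTranspose_reflection {κ : Type*} [DecidableEq κ] (μ : ℂ) (w : κ → ℂ) :
    (reflection μ w)ᴴ = reflection (star μ) w := by
  simp [reflection, Matrix.conjTranspose_vecMulVec]

theorem reflection_mulVec (μ : ℂ) (w x : ι → ℂ) :
    reflection μ w *ᵥ x = x + (μ * (star w ⬝ᵥ x)) • w := by
  rw [reflection, Matrix.add_mulVec, Matrix.one_mulVec, Matrix.smul_mulVec, Matrix.vecMulVec_mulVec]
  ext i
  simp
  ring

theorem IsReflecting.star {κ : Type*} [Fintype κ] {μ : ℂ} {w : κ → ℂ} (h : IsReflecting μ w) :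
    IsReflecting (star μ) w := by
  unfold IsReflecting at *
  rw [star_star, ← h]
  ring

theorem IsReflecting.reflection_mul {μ : ℂ} {w : ι → ℂ} (h : IsReflecting μ w) :
    reflection μ w * reflection (Star.star μ) w = 1 := by
  have h2 : vecMulVec w (Star.star w) * vecMulVec w (Star.star w) =
      (Star.star w ⬝ᵥ w) • vecMulVec w (Star.star w) := by
    rw [Matrix.vecMulVec_mul_vecMulVec]
    ext i j
    simp [Matrix.vecMulVec_apply]
    ring
  rw [reflection, reflection, Matrix.add_mul, Matrix.mul_add, Matrix.mul_add, Matrix.one_mul,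
    Matrix.mul_one, Matrix.one_mul, Matrix.smul_mul, Matrix.mul_smul, h2, smul_smul, smul_smul,
    add_assoc, ← add_smul, ← add_smul, show Star.star μ + (μ + μ * Star.star μ *
      (Star.star w ⬝ᵥ w)) = 0 from by rw [← h]; ring, zero_smul, add_zero]

theorem IsReflecting.mem_unitaryGroup {μ : ℂ} {w : ι → ℂ} (h : IsReflecting μ w) :
    reflection μ w ∈ Matrix.unitaryGroup ι ℂ := by
  rw [Matrix.mem_unitaryGroup_iff, Matrix.star_eq_conjTranspose, conjTranspose_reflection]
  exact h.reflection_mul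

/-- Two vectors of the same length are related by a reflection along their difference. -/
theorem exists_reflection_mulVec_eq (x y : ι → ℂ) (h : star x ⬝ᵥ x = star y ⬝ᵥ y) :
    ∃ μ, IsReflecting μ (x - y) ∧ reflection μ (x - y) *ᵥ x = y := by
  set g : ℂ := star (x - y) ⬝ᵥ x with hg
  have hgs : star g = star x ⬝ᵥ (x - y) := by
    rw [hg, Matrix.star_dotProduct, star_star, dotProduct_comm]
  have hw : star (x - y) ⬝ᵥ (x - y) = g + star g := by
    rw [hgs, hg]
    simp only [star_sub, sub_dotProduct, dotProduct_sub]
    rw [h]; ring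
  -- Equal lengths give `|x - y|² = g + star g`, which makes `-1/g` satisfy the unitarity condition.
  -- If `g = 0` then `x = y`, and the convention `0⁻¹ = 0` yields the identity.
  refine ⟨-g⁻¹, ?_, ?_⟩
  · unfold IsReflecting
    rw [hw]
    by_cases h0 : g = 0
    · simp [h0]
    · have h1 : star g ≠ 0 := star_ne_zero.mpr h0
      rw [star_neg, star_inv₀]
      field_simp
      ring
  · rw [reflection_mulVec, ← hg]
    by_cases h0 : g = 0
    · have : x - y = 0 := by
        rw [h0, star_zero, add_zero] at hw
        open scoped ComplexOrder in exact dotProduct_star_self_eq_zero.mp hw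
      rw [this, smul_zero, add_zero, sub_eq_zero.mp this]
    · rw [neg_mul, inv_mul_cancel₀ h0]
      simp

/-- The set of all unitary operators `1 + μ |w⟩⟨w|`. -/
def reflections (ι : Type*) [Fintype ι] [DecidableEq ι] : Set (Matrix ι ι ℂ) :=
  {A | ∃ μ w, IsReflecting μ w ∧ A = reflection μ w}

theorem star_col_dotProduct_col {U : Matrix ι ι ℂ} (hU : U ∈ Matrix.unitaryGroup ι ℂ) (i j : ι) :
    star (U *ᵥ Pi.single i 1) ⬝ᵥ (U *ᵥ Pi.single j 1) = if i = j then 1 else 0 := by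
  rw [Matrix.star_mulVec, dotProduct_mulVec, Matrix.vecMul_vecMul, ← Matrix.star_eq_conjTranspose,
    Matrix.mem_unitaryGroup_iff'.mp hU, Matrix.vecMul_one]
  simp [Pi.single_apply, eq_comm]

/-- Householder reduction: each reflection sends one more column to its basis vector. For a unitary
no triangular part is left over, so after `s.card` reflections the identity remains. -/
theorem mem_reflections_pow_card (s : Finset ι) (U : Matrix ι ι ℂ)
    (hU : U ∈ Matrix.unitaryGroup ι ℂ)
    (hs : ∀ j ∉ s, U *ᵥ Pi.single j 1 = Pi.single j 1) : U ∈ reflections ι ^ s.card := by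
  induction s using Finset.induction_on generalizing U with
  | empty =>
    have : U = 1 := by
      ext i j
      have := congrFun (hs j (by simp)) i
      simpa [Matrix.one_apply, Pi.single_apply] using this
    simp [this]
  | insert i s hi ih =>
    obtain ⟨μ, hμ, hx⟩ := exists_reflection_mulVec_eq (U *ᵥ Pi.single i 1) (Pi.single i 1)
      (by rw [star_col_dotProduct_col hU]; simp)
    set w := U *ᵥ Pi.single i 1 - Pi.single i 1 with hw
    have hmem : reflection μ w * U ∈ reflections ι ^ s.card := by
      refine ih _ (mul_mem hμ.mem_unitaryGroup hU) fun j hj => ?_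
      rw [← Matrix.mulVec_mulVec]
      by_cases hji : j = i
      · rw [hji, hx]
      · have hUj := hs j (by simp [hji, hj])
        -- Column `i` is orthogonal to the columns already reduced, so the new reflection does not
        -- disturb them.
        have hwj : w j = 0 := by
          have := star_col_dotProduct_col hU j i
          rw [hUj, if_neg hji] at this
          have h3 : (U *ᵥ Pi.single i 1) j = 0 := by
            rw [← this, dotProduct, Finset.sum_eq_single j] <;> simp +contextual
          simp [hw, hji] at h3 ⊢
          exact h3
        rw [hUj, reflection_mulVec]
        simp [hwj]
    have hfac : U = reflection (star μ) w * (reflection μ w * U) := by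
      have := hμ.star.reflection_mul
      rw [star_star] at this
      rw [← Matrix.mul_assoc, this, Matrix.one_mul]
    rw [Finset.card_insert_of_notMem hi, pow_succ', hfac]
    exact Set.mul_mem_mul ⟨_, _, hμ.star, rfl⟩ hmem

/-- Every unitary matrix is a product of as many reflections as its size. -/
theorem unitary_mem_reflections_pow (U : Matrix ι ι ℂ) (hU : U ∈ Matrix.unitaryGroup ι ℂ) :
    U ∈ reflections ι ^ Fintype.card ι :=
  mem_reflections_pow_card Finset.univ U hU fun j hj => absurd (Finset.mem_univ j) hj

/-- A unitary that takes `w` to a basis vector takes the reflection along `w` to a diagonal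
matrix. -/
theorem exists_reflection_eq_conj {μ : ℂ} {w : ι → ℂ} (hμ : IsReflecting μ w) {A : Matrix ι ι ℂ}
    (hA : A ∈ Matrix.unitaryGroup ι ℂ) {z : ℂ} {i : ι} (hz : A *ᵥ w = z • Pi.single i 1) :
    ∃ l : ℂ, ‖l‖ = 1 ∧
      reflection μ w = Aᴴ * (Matrix.diagonal fun j => if j = i then l else 1) * A := by
  have hA' : Aᴴ * A = 1 := Matrix.mem_unitaryGroup_iff'.mp hA
  have hs : star w ⬝ᵥ w = z * star z := by
    have h1 : star (A *ᵥ w) ⬝ᵥ (A *ᵥ w) = star w ⬝ᵥ w := by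
      rw [Matrix.star_mulVec, dotProduct_mulVec, Matrix.vecMul_vecMul, hA', Matrix.vecMul_one]
    rw [← h1, hz]
    simp [dotProduct, Pi.single_apply, mul_comm]
  -- This is the eigenvalue `1 + μ |w|²` of the reflection along `w`, since `A` preserves length.
  refine ⟨1 + μ * (z * star z), ?_, ?_⟩
  · have h2 : (1 + μ * (z * star z)) * star (1 + μ * (z * star z)) = 1 := by
      have := hμ
      unfold IsReflecting at this
      rw [hs] at this
      simp only [star_add, star_one, star_mul, star_star]
      linear_combination (z * star z) * this
    rw [← sq_eq_sq₀ (norm_nonneg _) zero_le_one, ← Complex.normSq_eq_norm_sq]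
    have h3 := Complex.mul_conj (1 + μ * (z * star z))
    rw [← Complex.star_def, h2] at h3
    rw [one_pow]
    exact_mod_cast h3.symm
  · have hd : (Matrix.diagonal fun j => if j = i then 1 + μ * (z * star z) else 1) =
        reflection μ (A *ᵥ w) := by
      ext j k
      rw [hz]
      by_cases hj : j = i <;> by_cases hk : k = i <;> by_cases hjk : j = k <;>
        simp_all [reflection, Matrix.vecMulVec_apply, mul_comm]
    rw [hd, reflection, reflection, Matrix.star_mulVec, ← Matrix.mul_vecMulVec,
      ← Matrix.vecMulVec_mul, Matrix.mul_add, Matrix.add_mul, Matrix.mul_one, hA', Matrix.mul_smul,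
      Matrix.smul_mul]
    congr 2
    rw [← Matrix.mul_assoc, ← Matrix.mul_assoc, hA', Matrix.one_mul, Matrix.mul_assoc, hA',
      Matrix.mul_one]

end Reflections

/-! ### One-qubit gates -/

section OneQubit

theorem sqrt_two_inv_mul_self : ((Real.sqrt 2 : ℝ) : ℂ)⁻¹ * ((Real.sqrt 2 : ℝ) : ℂ)⁻¹ = 2⁻¹ := by
  rw [← mul_inv, ← Complex.ofReal_mul, Real.mul_self_sqrt (by norm_num)]
  norm_num

theorem hGate_mul_mul_hGate (A : Matrix (Fin 2) (Fin 2) ℂ) :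
    hGate * A * hGate = (2 : ℂ)⁻¹ • (!![1, 1; 1, -1] * A * !![1, 1; 1, -1]) := by
  rw [hGate, Matrix.smul_mul, Matrix.smul_mul, Matrix.mul_smul, smul_smul, sqrt_two_inv_mul_self]

theorem hGate_mul_self : hGate * hGate = 1 := by
  have := hGate_mul_mul_hGate 1
  rw [Matrix.mul_one, Matrix.mul_one] at this
  rw [this]
  ext i j
  fin_cases i <;> fin_cases j <;> simp <;> norm_num

theorem conjTranspose_hGate : hGateᴴ = hGate := by
  ext i j
  fin_cases i <;> fin_cases j <;> simp [hGate]

theorem hGate_mem_unitaryGroup : hGate ∈ Matrix.unitaryGroup (Fin 2) ℂ := by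
  rw [Matrix.mem_unitaryGroup_iff, Matrix.star_eq_conjTranspose, conjTranspose_hGate,
    hGate_mul_self]

/-- The phase gate `diag(1, τ)`. -/
def phaseGate (τ : ℂ) : Matrix (Fin 2) (Fin 2) ℂ := !![1, 0; 0, τ]

theorem mul_star_eq_one {τ : ℂ} (h : ‖τ‖ = 1) : τ * star τ = 1 := by
  rw [Complex.star_def, Complex.mul_conj, Complex.normSq_eq_norm_sq, h]
  norm_num

theorem phaseGate_mem_unitaryGroup {τ : ℂ} (h : ‖τ‖ = 1) :
    phaseGate τ ∈ Matrix.unitaryGroup (Fin 2) ℂ := by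
  have h' := mul_star_eq_one h
  rw [Complex.star_def] at h'
  rw [Matrix.mem_unitaryGroup_iff]
  ext i j
  fin_cases i <;> fin_cases j <;> simp [phaseGate, Matrix.mul_apply, Matrix.star_apply, h']

theorem exists_phaseGate_eq_rzGate {τ : ℂ} (h : ‖τ‖ = 1) :
    ∃ (c : ℂ) (θ : ℝ), ‖c‖ = 1 ∧ phaseGate τ = c • rzGate θ := by
  refine ⟨Complex.exp (Complex.I * τ.arg / 2), τ.arg, ?_, ?_⟩
  · rw [show Complex.I * τ.arg / 2 = ((τ.arg / 2 : ℝ) : ℂ) * Complex.I by push_cast; ring]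
    exact Complex.norm_exp_ofReal_mul_I _
  · have h1 : Complex.exp (Complex.I * τ.arg / 2) * Complex.exp (Complex.I * τ.arg / 2) = τ := by
      rw [← Complex.exp_add]
      have := Complex.norm_mul_exp_arg_mul_I τ
      rw [h, Complex.ofReal_one, one_mul] at this
      rw [show Complex.I * τ.arg / 2 + Complex.I * τ.arg / 2 = τ.arg * Complex.I by ring, this]
    ext i j
    fin_cases i <;> fin_cases j <;> simp [phaseGate, rzGate, h1, ← Complex.exp_add]

theorem exists_unimodular_mul_norm (a : ℂ) : ∃ a' : ℂ, ‖a'‖ = 1 ∧ a = ‖a‖ * a' :=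
  ⟨Complex.exp (a.arg * Complex.I), Complex.norm_exp_ofReal_mul_I _,
    (Complex.norm_mul_exp_arg_mul_I a).symm⟩

/-- The Euler decomposition of a one-qubit unitary. -/
theorem exists_euler_phaseGate (U : Matrix (Fin 2) (Fin 2) ℂ)
    (hU : U ∈ Matrix.unitaryGroup (Fin 2) ℂ) :
    ∃ c τ₁ τ₂ τ₃ : ℂ, ‖c‖ = 1 ∧ ‖τ₁‖ = 1 ∧ ‖τ₂‖ = 1 ∧ ‖τ₃‖ = 1 ∧
      U = c • (phaseGate τ₁ * (hGate * phaseGate τ₂ * hGate) * phaseGate τ₃) := by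
  obtain ⟨a, ha, haU⟩ := exists_unimodular_mul_norm (U 0 0)
  obtain ⟨b, hb, hbU⟩ := exists_unimodular_mul_norm (U 0 1)
  have h1 := Matrix.mem_unitaryGroup_iff.mp hU
  -- Comparing the adjugate with the inverse expresses the second row through the first row and the
  -- determinant.
  have hadj : U.adjugate = U.det • star U := by
    have h2 := congrArg (fun M => M * U.adjugate) (Matrix.mem_unitaryGroup_iff'.mp hU)
    simp only [Matrix.mul_assoc, Matrix.mul_adjugate, Matrix.one_mul, Matrix.mul_smul,
      Matrix.mul_one] at h2
    exact h2.symm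
  have hdet : ‖U.det‖ = 1 := by
    have := Matrix.det_of_mem_unitary hU
    exact (CStarRing.norm_of_mem_unitary this)
  set δ := U.det
  rw [Matrix.adjugate_fin_two] at hadj
  have hd : U 1 1 = δ * star (U 0 0) := by simpa using congrFun (congrFun hadj 0) 0
  have hc : U 1 0 = -(δ * star (U 0 1)) := by
    have := congrFun (congrFun hadj 1) 0
    simp [Matrix.star_apply] at this
    rw [Complex.star_def, ← this, neg_neg]
  have hn : (‖U 0 0‖ : ℂ) ^ 2 + (‖U 0 1‖ : ℂ) ^ 2 = 1 := by
    have := congrFun (congrFun h1 0) 0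
    simp only [Matrix.mul_apply, Fin.sum_univ_two, Matrix.star_apply, Complex.star_def,
      Complex.mul_conj, Complex.normSq_eq_norm_sq] at this
    simpa using this
  generalize (‖U 0 0‖) = C at *
  generalize (‖U 0 1‖) = S at *
  have hρ : ((C : ℂ) + Complex.I * S) * (C - Complex.I * S) = 1 := by
    linear_combination hn - (S : ℂ) ^ 2 * Complex.I_sq
  have hnρ : ‖(C : ℂ) + Complex.I * S‖ = 1 := by
    rw [← sq_eq_sq₀ (norm_nonneg _) zero_le_one, ← Complex.normSq_eq_norm_sq]
    have : (C : ℝ) ^ 2 + S ^ 2 = 1 := by exact_mod_cast hn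
    simp [Complex.normSq_apply]
    nlinarith
  have ha' := mul_star_eq_one ha
  have hb' := mul_star_eq_one hb
  rw [Complex.star_def] at ha' hb'
  -- With `ρ = C + iS` of modulus one, `H diag(1, ρ²) H` is `ρ` times the matrix with `C` on the
  -- diagonal and `-iS` off it. The scalar cancels this `ρ`; the outer phases are read off from the
  -- entries of `U`.
  refine ⟨a * (C - Complex.I * S), -Complex.I * δ * star b * star a,
    (C + Complex.I * S) ^ 2, Complex.I * b * star a, ?_, ?_, ?_, ?_, ?_⟩
  · have := congrArg norm hρ
    rw [norm_mul, hnρ, norm_one, one_mul] at this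
    rw [norm_mul, ha, this, one_mul]
  · simp [ha, hb, hdet]
  · simp [hnρ]
  · simp [ha, hb]
  · have hM : hGate * phaseGate ((C + Complex.I * S) ^ 2) * hGate = ((C : ℂ) + Complex.I * S) •
        !![(C : ℂ), -Complex.I * S; -Complex.I * S, C] := by
      rw [hGate_mul_mul_hGate]
      ext i j
      fin_cases i <;> fin_cases j <;> simp [phaseGate] <;>
        linear_combination -hρ / 2
    rw [hM, Matrix.mul_smul, Matrix.smul_mul, smul_smul, mul_assoc,
      mul_comm ((C : ℂ) - _), hρ, mul_one]
    ext i j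
    fin_cases i <;> fin_cases j <;> simp only [Fin.zero_eta, Fin.mk_one, Fin.isValue, hd, hc] <;>
      rw [Matrix.smul_apply] <;> simp only [phaseGate, Matrix.mul_apply, Fin.sum_univ_two] <;>
      simp
    · rw [haU]; ring
    · rw [hbU]
      linear_combination S * b * (a * (starRingEnd ℂ) a) * Complex.I_sq - S * b * ha'
    · rw [hbU]
      simp only [map_mul, Complex.conj_ofReal]
      linear_combination δ * S * (starRingEnd ℂ) b * (ha' - (a * (starRingEnd ℂ) a) * Complex.I_sq)
    · rw [haU]
      simp only [map_mul, Complex.conj_ofReal]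
      linear_combination δ * C * (starRingEnd ℂ) a *
        ((a * (starRingEnd ℂ) a) * (b * (starRingEnd ℂ) b) * Complex.I_sq
          - (a * (starRingEnd ℂ) a) * hb' - ha')

theorem exists_euler (U : Matrix (Fin 2) (Fin 2) ℂ) (hU : U ∈ Matrix.unitaryGroup (Fin 2) ℂ) :
    ∃ (c : ℂ) (α β γ : ℝ), ‖c‖ = 1 ∧
      U = c • (rzGate α * (hGate * rzGate β * hGate) * rzGate γ) := by
  obtain ⟨c, τ₁, τ₂, τ₃, hc, h1, h2, h3, h⟩ := exists_euler_phaseGate U hU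
  obtain ⟨c₁, α, hc₁, e₁⟩ := exists_phaseGate_eq_rzGate h1
  obtain ⟨c₂, β, hc₂, e₂⟩ := exists_phaseGate_eq_rzGate h2
  obtain ⟨c₃, γ, hc₃, e₃⟩ := exists_phaseGate_eq_rzGate h3
  refine ⟨c * (c₃ * (c₁ * c₂)), α, β, γ, by simp [hc, hc₁, hc₂, hc₃], ?_⟩
  rw [h, e₁, e₂, e₃]
  simp only [Matrix.mul_smul, Matrix.smul_mul, smul_smul]
  congr 1
  ring

/-- The target is `|1⟩` because `phaseGate` acts nontrivially there, so conjugation turns a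
reflection along `u` into a phase gate. -/
theorem exists_unitary_mulVec_eq (u : Fin 2 → ℂ) :
    ∃ μ w, IsReflecting μ w ∧ ∃ z : ℂ, reflection μ w *ᵥ u = z • Pi.single 1 1 := by
  obtain ⟨μ, hμ, h⟩ := exists_reflection_mulVec_eq u
    ((Real.sqrt (‖u 0‖ ^ 2 + ‖u 1‖ ^ 2) : ℂ) • Pi.single 1 1) (by
      have h0 (z : ℂ) : (starRingEnd ℂ) z * z = (‖z‖ : ℂ) ^ 2 := by
        rw [mul_comm, Complex.mul_conj, Complex.normSq_eq_norm_sq]; norm_num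
      simp only [dotProduct, Fin.sum_univ_two, Pi.star_apply, Complex.star_def, h0]
      simp only [Pi.smul_apply, Pi.single_apply, smul_eq_mul]
      simp only [Fin.isValue, zero_ne_one, ↓reduceIte, mul_zero, norm_zero, mul_one,
        Complex.norm_real, Real.norm_eq_abs, sq_abs, ← Complex.ofReal_pow]
      rw [Real.sq_sqrt (by positivity)]
      push_cast; ring)
  exact ⟨μ, _, hμ, _, h⟩

end OneQubit


/-! ### Two-qubit gates -/

section TwoQubit

open scoped Pointwise Kronecker

/-- The `CZ` gate as an operator on two qubits. -/
noncomputable def czGate : Matrix (Fin 2 × Fin 2) (Fin 2 × Fin 2) ℂ :=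
  Matrix.diagonal fun p => czSign p.1 p.2

/-- The elementary two-qubit operators: the `CZ` gate and the products of one-qubit unitaries. -/
def elementary : Set (Matrix (Fin 2 × Fin 2) (Fin 2 × Fin 2) ℂ) :=
  {czGate} ∪ {M | ∃ A ∈ Matrix.unitaryGroup (Fin 2) ℂ, ∃ B ∈ Matrix.unitaryGroup (Fin 2) ℂ,
    M = A ⊗ₖ B}

/-- The operator `|0⟩⟨0| ⊗ A + |1⟩⟨1| ⊗ B`. -/
def multiplexer (A B : Matrix (Fin 2) (Fin 2) ℂ) : Matrix (Fin 2 × Fin 2) (Fin 2 × Fin 2) ℂ :=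
  Matrix.of fun p q => if p.1 = q.1 then (if p.1 = 0 then A else B) p.2 q.2 else 0

theorem multiplexer_mul (A B C D : Matrix (Fin 2) (Fin 2) ℂ) :
    multiplexer A B * multiplexer C D = multiplexer (A * C) (B * D) := by
  ext ⟨i, j⟩ ⟨k, l⟩
  fin_cases i <;> fin_cases k <;>
    simp [multiplexer, Matrix.mul_apply, Fintype.sum_prod_type]

theorem multiplexer_mulVec (A B : Matrix (Fin 2) (Fin 2) ℂ) (w : Fin 2 × Fin 2 → ℂ)
    (p : Fin 2 × Fin 2) : (multiplexer A B *ᵥ w) p =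
      if p.1 = 0 then (A *ᵥ fun j => w (0, j)) p.2 else (B *ᵥ fun j => w (1, j)) p.2 := by
  obtain ⟨i, j⟩ := p
  fin_cases i <;>
    simp [multiplexer, Matrix.mulVec, dotProduct, Fintype.sum_prod_type]

theorem one_kronecker_eq_multiplexer (A : Matrix (Fin 2) (Fin 2) ℂ) :
    (1 : Matrix (Fin 2) (Fin 2) ℂ) ⊗ₖ A = multiplexer A A := by
  ext ⟨i, j⟩ ⟨k, l⟩
  fin_cases i <;> fin_cases k <;> simp [multiplexer]

theorem phaseGate_kronecker_eq_multiplexer (τ : ℂ) (A : Matrix (Fin 2) (Fin 2) ℂ) :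
    phaseGate τ ⊗ₖ A = multiplexer A (τ • A) := by
  ext ⟨i, j⟩ ⟨k, l⟩
  fin_cases i <;> fin_cases k <;> simp [multiplexer, phaseGate]

theorem czGate_eq_multiplexer : czGate = multiplexer 1 zGate := by
  ext ⟨i, j⟩ ⟨k, l⟩
  fin_cases i <;> fin_cases j <;> fin_cases k <;> fin_cases l <;>
    simp [multiplexer, czGate, czSign, zGate]

theorem kronecker_mem_elementary {A B : Matrix (Fin 2) (Fin 2) ℂ}
    (hA : A ∈ Matrix.unitaryGroup (Fin 2) ℂ) (hB : B ∈ Matrix.unitaryGroup (Fin 2) ℂ) :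
    A ⊗ₖ B ∈ elementary := Or.inr ⟨A, hA, B, hB, rfl⟩

theorem one_kronecker_mem_elementary {A : Matrix (Fin 2) (Fin 2) ℂ}
    (hA : A ∈ Matrix.unitaryGroup (Fin 2) ℂ) : multiplexer A A ∈ elementary :=
  one_kronecker_eq_multiplexer A ▸ kronecker_mem_elementary (one_mem _) hA

theorem elementary_subset_unitaryGroup {M : Matrix (Fin 2 × Fin 2) (Fin 2 × Fin 2) ℂ}
    (hM : M ∈ elementary) : M ∈ Matrix.unitaryGroup (Fin 2 × Fin 2) ℂ := by
  rcases hM with rfl | ⟨A, hA, B, hB, rfl⟩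
  · rw [Matrix.mem_unitaryGroup_iff, Matrix.star_eq_conjTranspose, czGate,
      Matrix.diagonal_conjTranspose, Matrix.diagonal_mul_diagonal, ← Matrix.diagonal_one]
    congr 1
    ext p
    simp only [Pi.star_apply, czSign]
    split_ifs <;> simp
  · rw [Matrix.mem_unitaryGroup_iff] at *
    rw [Matrix.star_eq_conjTranspose] at *
    rw [Matrix.conjTranspose_kronecker, ← Matrix.mul_kronecker_mul, hA, hB, Matrix.one_kronecker_one]

theorem conjTranspose_mem_elementary {M : Matrix (Fin 2 × Fin 2) (Fin 2 × Fin 2) ℂ}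
    (hM : M ∈ elementary) : Mᴴ ∈ elementary := by
  rcases hM with rfl | ⟨A, hA, B, hB, rfl⟩
  · left
    rw [Set.mem_singleton_iff, czGate, Matrix.diagonal_conjTranspose]
    congr 1
    ext p
    simp only [Pi.star_apply, czSign]
    split_ifs <;> simp
  · rw [Matrix.conjTranspose_kronecker]
    exact kronecker_mem_elementary (Unitary.star_mem hA) (Unitary.star_mem hB)

theorem elementary_pow_subset_unitaryGroup {n : ℕ} {M : Matrix (Fin 2 × Fin 2) (Fin 2 × Fin 2) ℂ}
    (hM : M ∈ elementary ^ n) : M ∈ Matrix.unitaryGroup (Fin 2 × Fin 2) ℂ := by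
  induction n generalizing M with
  | zero => rw [pow_zero, Set.mem_one] at hM; exact hM ▸ one_mem _
  | succ n ih =>
    rw [pow_succ] at hM
    obtain ⟨A, hA, B, hB, rfl⟩ := Set.mem_mul.mp hM
    exact mul_mem (ih hA) (elementary_subset_unitaryGroup hB)

theorem conjTranspose_mem_elementary_pow {n : ℕ} {M : Matrix (Fin 2 × Fin 2) (Fin 2 × Fin 2) ℂ}
    (hM : M ∈ elementary ^ n) : Mᴴ ∈ elementary ^ n := by
  induction n generalizing M with
  | zero =>
    rw [pow_zero, Set.mem_one] at hM ⊢
    rw [hM, Matrix.conjTranspose_one]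
  | succ n ih =>
    rw [pow_succ] at hM
    obtain ⟨A, hA, B, hB, rfl⟩ := Set.mem_mul.mp hM
    rw [pow_succ', Matrix.conjTranspose_mul]
    exact Set.mul_mem_mul (conjTranspose_mem_elementary hB) (ih hA)

theorem exists_sq_eq_unimodular {l : ℂ} (h : ‖l‖ = 1) : ∃ σ : ℂ, ‖σ‖ = 1 ∧ σ * σ = l := by
  refine ⟨Complex.exp ((l.arg / 2 : ℝ) * Complex.I), Complex.norm_exp_ofReal_mul_I _, ?_⟩
  have := Complex.norm_mul_exp_arg_mul_I l
  rw [h, Complex.ofReal_one, one_mul] at this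
  rw [← Complex.exp_add, ← add_mul, ← Complex.ofReal_add, add_halves, this]

/-- The controlled phase gate `diag(1, 1, 1, l)` is a product of elementary operators. -/
theorem controlledPhase_mem {l : ℂ} (h : ‖l‖ = 1) :
    multiplexer 1 (phaseGate l) ∈ elementary ^ 6 := by
  obtain ⟨σ, hσ, rfl⟩ := exists_sq_eq_unimodular h
  have hσ' : σ * (starRingEnd ℂ) σ = 1 := mul_star_eq_one hσ
  have hσs : ‖star σ‖ = 1 := by simpa using hσ
  have hH := one_kronecker_mem_elementary hGate_mem_unitaryGroup
  have hZ : multiplexer 1 zGate ∈ elementary := Or.inl czGate_eq_multiplexer.symm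
  have hP : multiplexer (phaseGate σ) (σ • phaseGate σ) ∈ elementary :=
    phaseGate_kronecker_eq_multiplexer σ _ ▸
      kronecker_mem_elementary (phaseGate_mem_unitaryGroup hσ) (phaseGate_mem_unitaryGroup hσ)
  have hD := one_kronecker_mem_elementary (mul_mem (mul_mem hGate_mem_unitaryGroup
    (phaseGate_mem_unitaryGroup hσs)) hGate_mem_unitaryGroup)
  -- With control `0` the word collapses to `diag(1, σ) diag(1, star σ) = 1`. With control `1` the
  -- two `CZ` gates become `X = HZH`, flipping the second factor: `σ diag(1, σ) diag(star σ, 1) =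
  -- diag(1, σ²)`.
  have hmem := Set.mul_mem_mul (Set.mul_mem_mul (Set.mul_mem_mul (Set.mul_mem_mul
    (Set.mul_mem_mul hP hH) hZ) hD) hZ) hH
  simp only [multiplexer_mul, ← pow_succ, ← sq] at hmem
  convert hmem using 2
  · simp only [Matrix.mul_one, Matrix.mul_assoc, hGate_mul_self]
    rw [← Matrix.mul_assoc hGate hGate, hGate_mul_self, Matrix.one_mul]
    ext i j
    fin_cases i <;> fin_cases j <;> simp [phaseGate, hσ']
  · have hX : hGate * zGate * hGate = !![0, 1; 1, 0] := by
      rw [hGate_mul_mul_hGate]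
      ext i j
      fin_cases i <;> fin_cases j <;> simp [zGate] <;> norm_num
    have : σ • phaseGate σ * hGate * zGate * (hGate * phaseGate (star σ) * hGate) * zGate * hGate =
        σ • phaseGate σ * (hGate * zGate * hGate) * phaseGate (star σ) *
          (hGate * zGate * hGate) := by
      simp only [Matrix.mul_assoc]
    rw [this, hX]
    ext i j
    fin_cases i <;> fin_cases j <;> simp [phaseGate, hσ']

/-- The diagonalising unitary need not be controlled: on the control-`0` branch it cancels against
its adjoint. The length is `1 + 6 + 1`. -/
theorem controlled_reflection_mem {μ : ℂ} {w : Fin 2 → ℂ} (h : IsReflecting μ w) :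
    multiplexer 1 (reflection μ w) ∈ elementary ^ 8 := by
  obtain ⟨μ', w', h', z, hz⟩ := exists_unitary_mulVec_eq w
  obtain ⟨l, hl, heq⟩ := exists_reflection_eq_conj h h'.mem_unitaryGroup hz
  have hA := h'.mem_unitaryGroup
  have h1 := one_kronecker_mem_elementary hA
  have h2 := one_kronecker_mem_elementary (Unitary.star_mem hA)
  have hmem := Set.mul_mem_mul (Set.mul_mem_mul h2 (controlledPhase_mem hl)) h1
  rw [← pow_succ', ← pow_succ, multiplexer_mul, multiplexer_mul, Matrix.mul_one,
    Matrix.mem_unitaryGroup_iff'.mp hA] at hmem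
  convert hmem using 2
  rw [heq, Matrix.star_eq_conjTranspose]
  congr 2
  ext i j
  fin_cases i <;> fin_cases j <;> simp [phaseGate]

/-- Every two-qubit vector is taken to a multiple of `|11⟩` by a short product of elementary
operators. -/
theorem exists_elementary_mulVec_eq (w : Fin 2 × Fin 2 → ℂ) :
    ∃ W ∈ elementary ^ 10, ∃ z : ℂ, W *ᵥ w = z • Pi.single (1, 1) 1 := by
  -- The half with first bit `0` is turned to `p|1⟩`, then a controlled reflection turns the other
  -- half to `q|1⟩` without touching the first. What is left is the product `(p, q) ⊗ |1⟩`, settled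
  -- on the first qubit. The length is `1 + 8 + 1`.
  obtain ⟨μ, a, ha, p, hp⟩ := exists_unitary_mulVec_eq fun j => w (0, j)
  obtain ⟨μ', a', ha', q, hq⟩ := exists_unitary_mulVec_eq (reflection μ a *ᵥ fun j => w (1, j))
  obtain ⟨μ'', b, hb, z, hz⟩ := exists_unitary_mulVec_eq ![p, q]
  have hmem := Set.mul_mem_mul (Set.mul_mem_mul
    (kronecker_mem_elementary hb.mem_unitaryGroup (one_mem (Matrix.unitaryGroup (Fin 2) ℂ)))
    (controlled_reflection_mem ha')) (one_kronecker_mem_elementary ha.mem_unitaryGroup)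
  rw [← pow_succ', ← pow_succ] at hmem
  refine ⟨_, hmem, z, ?_⟩
  have h1 : multiplexer 1 (reflection μ' a') *ᵥ
      (multiplexer (reflection μ a) (reflection μ a) *ᵥ w) =
      fun x => ![p, q] x.1 * (Pi.single 1 1 : Fin 2 → ℂ) x.2 := by
    ext ⟨i, j⟩
    rw [multiplexer_mulVec]
    simp only [multiplexer_mulVec, if_true, one_ne_zero, if_false, hp, hq, Matrix.one_mulVec]
    fin_cases i <;> simp
  rw [← Matrix.mulVec_mulVec, ← Matrix.mulVec_mulVec, h1]
  ext ⟨i, j⟩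
  have := congrFun hz i
  obtain rfl | rfl : i = 0 ∨ i = 1 := by omega
  all_goals obtain rfl | rfl : j = 0 ∨ j = 1 := by omega
  all_goals
    simp only [Matrix.mulVec, dotProduct, Fin.sum_univ_two] at this
    simp only [Matrix.mulVec, dotProduct, Fintype.sum_prod_type, Fin.sum_univ_two,
      Matrix.kroneckerMap_apply]
    simp_all

/-- Taking the vector to `|11⟩` conjugates the reflection into a controlled phase, of length `10 + 6
+ 10`. -/
theorem reflection_mem_elementary_pow {M : Matrix (Fin 2 × Fin 2) (Fin 2 × Fin 2) ℂ}
    (hM : M ∈ reflections (Fin 2 × Fin 2)) : M ∈ elementary ^ 26 := by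
  obtain ⟨μ, w, h, rfl⟩ := hM
  obtain ⟨W, hW, z, hz⟩ := exists_elementary_mulVec_eq w
  obtain ⟨l, hl, heq⟩ := exists_reflection_eq_conj h (elementary_pow_subset_unitaryGroup hW) hz
  have hmem := Set.mul_mem_mul (Set.mul_mem_mul (conjTranspose_mem_elementary_pow hW)
    (controlledPhase_mem hl)) hW
  rw [← pow_add, ← pow_add] at hmem
  convert hmem using 2
  rw [heq]
  congr 2
  ext ⟨i, j⟩ ⟨i', j'⟩
  fin_cases i <;> fin_cases i' <;> fin_cases j <;> fin_cases j' <;>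
    simp [multiplexer, phaseGate]

/-- The `CZ` gate and the one-qubit gates generate all two-qubit unitaries, in bounded length. -/
theorem unitary_mem_elementary_pow {U : Matrix (Fin 2 × Fin 2) (Fin 2 × Fin 2) ℂ}
    (hU : U ∈ Matrix.unitaryGroup (Fin 2 × Fin 2) ℂ) : U ∈ elementary ^ 104 := by
  have h1 := unitary_mem_reflections_pow U hU
  have h2 : reflections (Fin 2 × Fin 2) ⊆ elementary ^ 26 := fun _ => reflection_mem_elementary_pow
  have h3 := Set.pow_subset_pow_left h2 (n := Fintype.card (Fin 2 × Fin 2)) h1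
  rwa [← pow_mul] at h3

end TwoQubit


/-! ### Embedding two-qubit operators into a register -/

section Embed

open scoped Pointwise Kronecker

variable {Q : Type*} [Fintype Q] [DecidableEq Q]

open Classical in
/-- The two-qubit operator `U` acting on the qubits `p` and `q` of a register. -/
noncomputable def embed {Q : Type*} (p q : Q) (U : Matrix (Fin 2 × Fin 2) (Fin 2 × Fin 2) ℂ) : Op Q :=
  Matrix.of fun a b =>
    if ∀ s, s ≠ p → s ≠ q → a s = b s then U (a p, a q) (b p, b q) else 0

theorem embed_mulVec {p q : Q} (hpq : p ≠ q) (U : Matrix (Fin 2 × Fin 2) (Fin 2 × Fin 2) ℂ)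
    (ψ : Bits Q → ℂ) (a : Bits Q) : (embed p q U *ᵥ ψ) a =
      ∑ i : Fin 2 × Fin 2, U (a p, a q) i *
        ψ (Function.update (Function.update a p i.1) q i.2) := by
  symm
  refine Fintype.sum_of_injective
    (fun i : Fin 2 × Fin 2 => Function.update (Function.update a p i.1) q i.2) ?_ _ _ ?_ ?_
  · rintro ⟨i, j⟩ ⟨i', j'⟩ h
    have h1 := congrFun h p
    have h2 := congrFun h q
    simp [hpq] at h1 h2
    rw [h1, h2]
  · intro b hb
    simp only [embed, Matrix.of_apply]
    rw [if_neg, zero_mul]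
    intro h
    refine hb ⟨(b p, b q), ?_⟩
    ext s
    by_cases hq : s = q
    · simp [hq]
    · by_cases hp : s = p
      · simp [hp, hpq]
      · simp [hp, hq, h s hp hq]
  · intro i
    simp only [embed, Matrix.of_apply]
    rw [if_pos fun s hp hq => by simp [hp, hq]]
    simp [hpq]

theorem embed_mul {p q : Q} (hpq : p ≠ q) (U V : Matrix (Fin 2 × Fin 2) (Fin 2 × Fin 2) ℂ) :
    embed p q (U * V) = embed p q U * embed p q V := by
  refine Matrix.ext_of_mulVec_single fun b => ?_
  ext a
  rw [← Matrix.mulVec_mulVec, embed_mulVec hpq, embed_mulVec hpq]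
  simp only [embed_mulVec hpq, Matrix.mul_apply, Finset.sum_mul, Finset.mul_sum]
  rw [Finset.sum_comm]
  refine Finset.sum_congr rfl fun i _ => Finset.sum_congr rfl fun j _ => ?_
  rw [mul_assoc]
  congr 2
  · simp [hpq]
  · congr 1
    ext s
    by_cases hq : s = q
    · simp [hq]
    · by_cases hp : s = p
      · simp [hp, hpq]
      · simp [hp, hq]

theorem embed_kronecker {p q : Q} (hpq : p ≠ q) (A B : Matrix (Fin 2) (Fin 2) ℂ) :
    embed p q (A ⊗ₖ B) = layer fun s => if s = p then A else if s = q then B else 1 := by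
  ext a b
  simp only [embed, Matrix.of_apply, layer_apply, Matrix.kroneckerMap_apply]
  split_ifs with h
  · rw [Fintype.prod_eq_mul p q hpq]
    · simp [hpq.symm]
    · rintro s ⟨hp, hq⟩
      simp only [hp, hq, if_false, h s hp hq, Matrix.one_apply_eq]
  · push Not at h
    obtain ⟨s, hp, hq, hs⟩ := h
    exact (Finset.prod_eq_zero (Finset.mem_univ s) (by simp [hp, hq, hs])).symm

theorem embed_czGate (p q : Q) :
    embed p q czGate = Matrix.diagonal fun b => czSign (b p) (b q) := by
  ext a b
  simp only [embed, czGate, Matrix.of_apply, Matrix.diagonal_apply, Prod.mk.injEq]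
  by_cases h : a = b
  · simp [h]
  · rw [if_neg h]
    split_ifs with h1 h2
    · exact absurd (funext fun s => by
        by_cases hp : s = p
        · rw [hp, h2.1]
        · by_cases hq : s = q
          · rw [hq, h2.2]
          · exact h1 s hp hq) h
    · rfl
    · rfl

theorem czSign_comm (a b : Fin 2) : czSign a b = czSign b a := by
  simp only [czSign, and_comm]

theorem embed_one {p q : Q} (hpq : p ≠ q) : embed p q 1 = 1 := by
  have := embed_kronecker hpq 1 1
  rw [Matrix.one_kronecker_one] at this
  simp [this, layer_one]

/-- The gate exchanging two qubits. -/
def swapGate : Matrix (Fin 2 × Fin 2) (Fin 2 × Fin 2) ℂ :=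
  Matrix.of fun x y => if y = x.swap then 1 else 0

theorem swapGate_mem_unitaryGroup : swapGate ∈ Matrix.unitaryGroup (Fin 2 × Fin 2) ℂ := by
  rw [Matrix.mem_unitaryGroup_iff]
  ext x y
  simp only [swapGate, Matrix.mul_apply, Matrix.star_apply, Matrix.of_apply, Matrix.one_apply]
  rw [Finset.sum_eq_single x.swap (by simp +contextual) (by simp)]
  simp [Prod.swap_inj, apply_ite]

theorem embed_swapGate_mulVec {p q : Q} (hpq : p ≠ q) (ψ : Bits Q → ℂ) (a : Bits Q) :
    (embed p q swapGate *ᵥ ψ) a = ψ (a ∘ Equiv.swap p q) := by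
  rw [embed_mulVec hpq, Finset.sum_eq_single (a q, a p)]
  · simp only [swapGate, Matrix.of_apply, Prod.swap_prod_mk, if_true, one_mul]
    congr 1
    ext s
    by_cases hq : s = q
    · simp [hq]
    · by_cases hp : s = p
      · simp [hp, hpq]
      · simp [hp, hq, Equiv.swap_apply_of_ne_of_ne]
  · intro i _ hi
    simp [swapGate, hi]
  · simp

/-- With `s` the neighbour of `p` on the side of `q`, this shortens the distance of a `CZ` by one
site. -/
theorem embed_czGate_eq_swap_conj {p q s : Q} (hps : p ≠ s) (hpq : p ≠ q) (hsq : s ≠ q) :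
    embed p q czGate = embed p s swapGate * embed s q czGate * embed p s swapGate := by
  refine Matrix.ext_of_mulVec_single fun b => ?_
  ext a
  rw [← Matrix.mulVec_mulVec, ← Matrix.mulVec_mulVec, embed_swapGate_mulVec hps, embed_czGate,
    embed_czGate, Matrix.mulVec_diagonal, Matrix.mulVec_diagonal, embed_swapGate_mulVec hps]
  congr 2
  · simp
  · simp [Equiv.swap_apply_of_ne_of_ne hpq.symm hsq.symm]
  · ext t
    simp

theorem czPhase_eq_prod (G : SimpleGraph Q) (E : Finset (Sym2 Q)) (hE : ∀ e, e ∈ E ↔ e ∈ G.edgeSet)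
    (b : Bits Q) : czPhase G b = ∏ e ∈ E, if ∀ u ∈ e, b u = 1 then -1 else 1 := by
  classical
  unfold czPhase
  refine Finset.prod_congr ?_ fun e _ => by congr
  ext e
  rw [SimpleGraph.mem_edgeFinset, hE]

theorem prod_sign_mk (b : Bits Q) (p q : Q) :
    (if ∀ u ∈ s(p, q), b u = 1 then (-1 : ℂ) else 1) = czSign (b p) (b q) := by
  simp [czSign, Sym2.mem_iff]

theorem czPhase_edge {p q : Q} (hpq : p ≠ q) (b : Bits Q) :
    czPhase (SimpleGraph.edge p q) b = czSign (b p) (b q) := by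
  rw [czPhase_eq_prod _ {s(p, q)} (fun e => by
    rw [SimpleGraph.edgeSet_edge_of_ne hpq, Finset.mem_singleton, Set.mem_singleton_iff]),
    Finset.prod_singleton, prod_sign_mk]

theorem czLayer_edge {p q : Q} (hpq : p ≠ q) :
    czLayer (SimpleGraph.edge p q) = embed p q czGate := by
  rw [czLayer_eq_diagonal, embed_czGate]
  congr 1
  ext b
  exact czPhase_edge hpq b

theorem czLayer_bot : czLayer (⊥ : SimpleGraph Q) = 1 := by
  rw [czLayer_eq_diagonal, ← Matrix.diagonal_one]
  congr 1
  ext b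
  rw [czPhase_eq_prod _ ∅ (by simp), Finset.prod_empty]

end Embed

/-! ### Compilation into one-dimensional layered circuits -/

section Compile

open scoped Pointwise Kronecker

/-- The operators implemented, up to a phase, by one round of a 1D circuit. -/
def roundSet (m : ℕ) : Set (Op (Fin m)) :=
  {M | ∃ (c : ℂ) (θ : Fin m → ℝ) (G : SimpleGraph (Fin m)), ‖c‖ = 1 ∧
    G ≤ SimpleGraph.pathGraph m ∧
    M = c • (czLayer G * layer (fun i => rzGate (θ i)) * layer fun _ => hGate)}

variable {m : ℕ}

theorem layer_hGate_mul_self {Q : Type*} [Fintype Q] [DecidableEq Q] :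
    (layer fun _ : Q => hGate) * (layer fun _ => hGate) = 1 := by
  rw [layer_mul, ← layer_one]
  simp only [hGate_mul_self]

theorem rzGate_zero : rzGate 0 = 1 := by
  ext i j
  fin_cases i <;> fin_cases j <;> simp [rzGate]

theorem czLayer_mul_hGate_mem {G : SimpleGraph (Fin m)} (hG : G ≤ SimpleGraph.pathGraph m) :
    czLayer G * (layer fun _ => hGate) ∈ roundSet m :=
  ⟨1, fun _ => 0, G, norm_one, hG, by simp [rzGate_zero, layer_one]⟩

theorem smul_layer_rz_mul_hGate_mem {c : ℂ} (hc : ‖c‖ = 1) (θ : Fin m → ℝ) :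
    c • (layer (fun i => rzGate (θ i)) * (layer fun _ => hGate)) ∈ roundSet m :=
  ⟨c, θ, ⊥, hc, bot_le, by rw [czLayer_bot, Matrix.one_mul]⟩

theorem layer_hGate_mem : (layer fun _ : Fin m => hGate) ∈ roundSet m := by
  simpa [czLayer_bot] using czLayer_mul_hGate_mem (bot_le (a := SimpleGraph.pathGraph m))

/-- A round always carries a Hadamard layer, which a second round can undo. Counting rounds in pairs
therefore allows short words to be padded to a prescribed length. -/
theorem one_mem_roundSet_sq : (1 : Op (Fin m)) ∈ roundSet m ^ 2 := by
  rw [sq, ← layer_hGate_mul_self]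
  exact Set.mul_mem_mul layer_hGate_mem layer_hGate_mem

theorem mem_pow_of_le {M : Op (Fin m)} {n n' : ℕ} (h : n ≤ n') (hM : M ∈ (roundSet m ^ 2) ^ n) :
    M ∈ (roundSet m ^ 2) ^ n' := Set.pow_subset_pow_right one_mem_roundSet_sq h hM

theorem czLayer_mem {G : SimpleGraph (Fin m)} (hG : G ≤ SimpleGraph.pathGraph m) :
    czLayer G ∈ roundSet m ^ 2 := by
  have := Set.mul_mem_mul (czLayer_mul_hGate_mem hG) layer_hGate_mem
  rwa [Matrix.mul_assoc, layer_hGate_mul_self, Matrix.mul_one, ← sq] at this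

/-- Three rounds supply the Euler angles of all qubits in parallel, and a bare Hadamard round
cancels the surplus Hadamard that would act first. -/
theorem layer_mem (U : Fin m → Matrix (Fin 2) (Fin 2) ℂ)
    (hU : ∀ i, U i ∈ Matrix.unitaryGroup (Fin 2) ℂ) : layer U ∈ (roundSet m ^ 2) ^ 2 := by
  choose c α β γ hc h using fun i => exists_euler (U i) (hU i)
  have hmem := Set.mul_mem_mul (Set.mul_mem_mul (Set.mul_mem_mul
    (smul_layer_rz_mul_hGate_mem (c := ∏ i, c i) (by simp [hc]) α)
    (smul_layer_rz_mul_hGate_mem norm_one β)) (smul_layer_rz_mul_hGate_mem norm_one γ))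
    (layer_hGate_mem (m := m))
  rw [← sq, ← pow_succ, ← pow_succ] at hmem
  rw [← pow_mul]
  convert hmem using 1
  rw [funext h, layer_smul]
  simp only [one_smul, layer_mul, Matrix.smul_mul, Matrix.mul_assoc, hGate_mul_self, Matrix.mul_one]

theorem embed_mem_of_elementary {p q : Fin m} (hpq : p ≠ q) {n : ℕ} (hn : 2 ≤ n)
    (hcz : embed p q czGate ∈ (roundSet m ^ 2) ^ n) {N : ℕ}
    {U : Matrix (Fin 2 × Fin 2) (Fin 2 × Fin 2) ℂ} (hU : U ∈ elementary ^ N) :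
    embed p q U ∈ (roundSet m ^ 2) ^ (n * N) := by
  induction N generalizing U with
  | zero =>
    rw [pow_zero, Set.mem_one] at hU
    simp [hU, embed_one hpq]
  | succ N ih =>
    rw [pow_succ] at hU
    obtain ⟨A, hA, B, hB, rfl⟩ := Set.mem_mul.mp hU
    rw [mul_add, mul_one, pow_add, embed_mul hpq]
    refine Set.mul_mem_mul (ih hA) ?_
    rcases hB with rfl | ⟨C, hC, D, hD, rfl⟩
    · exact hcz
    · rw [embed_kronecker hpq]
      refine mem_pow_of_le hn (layer_mem _ fun s => ?_)
      split_ifs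
      exacts [hC, hD, one_mem _]

/-- Each extra site costs two nearest-neighbour swaps, each of 104 elementary operators at two pairs
of rounds: `416 = 2 * 104 * 2`. -/
theorem embed_czGate_mem_of_lt (d : ℕ) (p q : Fin m) (h : (p : ℕ) + d + 1 = q) :
    embed p q czGate ∈ (roundSet m ^ 2) ^ (2 + 416 * d) := by
  have hadj (p q : Fin m) (h : (p : ℕ) + 1 = q) : embed p q czGate ∈ (roundSet m ^ 2) ^ 2 := by
    have hne : p ≠ q := fun e => by rw [e] at h; omega
    rw [← czLayer_edge hne]
    refine mem_pow_of_le one_le_two ?_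
    rw [pow_one]
    exact czLayer_mem ((SimpleGraph.edge_le_iff _).mpr
      (Or.inr (SimpleGraph.pathGraph_adj.mpr (Or.inl h))))
  induction d generalizing p with
  | zero => exact hadj p q h
  | succ d ih =>
    let s : Fin m := ⟨p + 1, by omega⟩
    have hps : p ≠ s := fun e => by have := congrArg Fin.val e; simp [s] at this
    have hpq : p ≠ q := fun e => by rw [e] at h; omega
    have hsq : s ≠ q := fun e => by rw [← e] at h; simp [s] at h
    have hswap := embed_mem_of_elementary hps le_rfl (hadj p s rfl)
      (unitary_mem_elementary_pow swapGate_mem_unitaryGroup)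
    have := Set.mul_mem_mul (Set.mul_mem_mul hswap (ih s (by simp [s]; omega))) hswap
    rw [← embed_czGate_eq_swap_conj hps hpq hsq, ← pow_add, ← pow_add] at this
    convert this using 2
    ring

/-- The number of pairs of rounds that suffice for a two-qubit gate. -/
def gateRounds (m : ℕ) : ℕ := (2 + 416 * m) * 104

theorem embed_mem {p q : Fin m} (hpq : p ≠ q) {U : Matrix (Fin 2 × Fin 2) (Fin 2 × Fin 2) ℂ}
    (hU : U ∈ Matrix.unitaryGroup (Fin 2 × Fin 2) ℂ) :
    embed p q U ∈ (roundSet m ^ 2) ^ gateRounds m := by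
  have hcz : embed p q czGate ∈ (roundSet m ^ 2) ^ (2 + 416 * m) := by
    rcases lt_or_gt_of_ne hpq with h | h
    · exact mem_pow_of_le (by omega) (embed_czGate_mem_of_lt (q - p - 1) p q (by omega))
    · have := embed_czGate_mem_of_lt (p - q - 1) q p (by omega)
      rw [embed_czGate] at this ⊢
      rw [show (fun b : Bits (Fin m) => czSign (b p) (b q)) = fun b => czSign (b q) (b p) from
        funext fun _ => czSign_comm _ _]
      exact mem_pow_of_le (by omega) this
  have := embed_mem_of_elementary hpq (Nat.le_add_right 2 _) hcz (unitary_mem_elementary_pow hU)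
  rwa [gateRounds]

theorem op_one_eq_layer {Q : Type*} [Fintype Q] [DecidableEq Q] (q : Q)
    (U : Matrix.unitaryGroup (Fin 2) ℂ) :
    (Gate.one q U).op = layer (Function.update (fun _ => 1) q U.1) := by
  ext a b
  simp only [Gate.op, Matrix.of_apply, layer_apply]
  split_ifs with h
  · rw [Fintype.prod_eq_single q]
    · simp
    · intro s hs
      simp [hs, h s hs]
  · push Not at h
    obtain ⟨s, hs, hne⟩ := h
    exact (Finset.prod_eq_zero (Finset.mem_univ s) (by simp [hs, hne])).symm

theorem op_two_eq_embed {Q : Type*} (p q : Q) (hpq : p ≠ q)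
    (U : Matrix.unitaryGroup (Fin 2 × Fin 2) ℂ) : (Gate.two p q hpq U).op = embed p q U.1 := rfl

theorem circuitOp_cons {Q : Type*} [Fintype Q] [DecidableEq Q] (g : Gate Q) (c : Circuit Q) :
    circuitOp (g :: c) = circuitOp c * g.op := by
  simp [circuitOp]

theorem twoQubitCount_cons_one {Q : Type*} (q : Q) (U : Matrix.unitaryGroup (Fin 2) ℂ)
    (C : Circuit Q) : twoQubitCount (Gate.one q U :: C) = twoQubitCount C := by
  simp [twoQubitCount, Gate.isTwo]

theorem twoQubitCount_cons_two {Q : Type*} (p q : Q) (hpq : p ≠ q)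
    (U : Matrix.unitaryGroup (Fin 2 × Fin 2) ℂ) (C : Circuit Q) :
    twoQubitCount (Gate.two p q hpq U :: C) = twoQubitCount C + 1 :=
  List.countP_cons_of_pos rfl

/-- A circuit is a layer of one-qubit unitaries followed by a number of rounds that is proportional
to the number of its two-qubit gates. -/
theorem exists_circuitOp_eq_mul_layer (C : Circuit (Fin m)) :
    ∃ X ∈ (roundSet m ^ 2) ^ ((gateRounds m + 2) * twoQubitCount C),
      ∃ U : Fin m → Matrix (Fin 2) (Fin 2) ℂ, (∀ i, U i ∈ Matrix.unitaryGroup (Fin 2) ℂ) ∧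
        circuitOp C = X * layer U := by
  induction C with
  | nil =>
    exact ⟨1, by simp [twoQubitCount], fun _ => 1, fun _ => one_mem _,
      by simp [circuitOp, layer_one]⟩
  | cons g C ih =>
    obtain ⟨X, hX, U, hU, h⟩ := ih
    -- The gate peeled off is the earliest one. A one-qubit gate merges into the pending layer at no
    -- cost; a two-qubit gate forces that layer to be compiled, which is the `+ 2`, and leaves a
    -- trivial one.
    cases g with
    | one q V =>
      refine ⟨X, by rwa [twoQubitCount_cons_one],
        fun i => U i * (Function.update (fun _ => 1) q V.1 : Fin m → Matrix (Fin 2) (Fin 2) ℂ) i,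
        fun i => ?_, ?_⟩
      · refine mul_mem (hU i) ?_
        by_cases hi : i = q
        · rw [hi, Function.update_self]
          exact V.2
        · rw [Function.update_of_ne hi]
          exact one_mem _
      · rw [circuitOp_cons, h, Matrix.mul_assoc, op_one_eq_layer, layer_mul]
    | two p q hpq V =>
      refine ⟨X * (layer U * embed p q V.1), ?_, fun _ => 1, fun _ => one_mem _, ?_⟩
      · rw [twoQubitCount_cons_two, mul_add, mul_one, pow_add]
        refine Set.mul_mem_mul hX ?_
        rw [add_comm, pow_add]
        exact Set.mul_mem_mul (layer_mem U hU) (embed_mem hpq V.2)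
      · rw [circuitOp_cons, h, op_two_eq_embed, layer_one, Matrix.mul_one, Matrix.mul_assoc]

/-- The number of rounds, minus one, into which a circuit on `m` qubits with `l` two-qubit gates is
compiled. -/
def compiledRounds (m l : ℕ) : ℕ := 2 * ((gateRounds m + 2) * l + 2) - 1

theorem circuitOp_mem (C : Circuit (Fin m)) :
    circuitOp C ∈ roundSet m ^ (compiledRounds m (twoQubitCount C) + 1) := by
  obtain ⟨X, hX, U, hU, h⟩ := exists_circuitOp_eq_mul_layer C
  have := Set.mul_mem_mul hX (layer_mem U hU)
  rw [← h, ← pow_add, ← pow_mul] at this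
  have hr : compiledRounds m (twoQubitCount C) + 1 =
      2 * ((gateRounds m + 2) * twoQubitCount C + 2) := by
    unfold compiledRounds; omega
  rwa [hr]

theorem member_zero {k : ℕ} (D : LayeredCircuit m (k + 1)) :
    D.member 0 = timeOrdered D.round := by
  rw [timeOrdered_succ_last, LayeredCircuit.member]
  simp [layer_one]

theorem timeOrdered_smul {Q : Type*} [Fintype Q] [DecidableEq Q] {k : ℕ} (c : Fin k → ℂ)
    (M : Fin k → Op Q) : (timeOrdered fun j => c j • M j) = (∏ j, c j) • timeOrdered M := by
  induction k with
  | zero => simp [timeOrdered_zero]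
  | succ k ih =>
    rw [timeOrdered_succ, ih, timeOrdered_succ M, Fin.prod_univ_succ, Matrix.smul_mul,
      Matrix.mul_smul, smul_smul, mul_comm]

/-- A product of rounds is the unitary of a 1D circuit, up to a phase. -/
theorem exists_layeredCircuit {k : ℕ} {M : Op (Fin m)} (hM : M ∈ roundSet m ^ (k + 1)) :
    ∃ (D : LayeredCircuit m (k + 1)) (c : ℂ), ‖c‖ = 1 ∧ M = c • D.member 0 := by
  obtain ⟨f, hf⟩ := Set.mem_pow.mp hM
  choose c θ G hc hG h using fun j => (f j).2
  -- The leftmost factor of a product acts last, so the rounds are indexed in reverse.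
  refine ⟨⟨fun j => θ j.rev, fun j => G j.rev, fun j => hG j.rev⟩, ∏ j : Fin (k + 1), c j.rev,
    by simp [hc], ?_⟩
  rw [member_zero, ← timeOrdered_smul, ← hf, timeOrdered]
  congr 1
  refine List.ext_getElem (by simp) fun i h1 h2 => ?_
  simp only [List.length_ofFn] at h1
  have hi : (⟨k - i, by omega⟩ : Fin (k + 1)).rev = ⟨i, h1⟩ := by
    ext; simp [Fin.val_rev]; omega
  simp [h, LayeredCircuit.round, hi, -List.ofFn_succ]

theorem conjChannel_smul {ι : Type*} [Fintype ι] {c : ℂ} (hc : ‖c‖ = 1) (U : Matrix ι ι ℂ) :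
    conjChannel (c • U) = conjChannel U := by
  ext1 ρ
  simp only [conjChannel, Matrix.conjTranspose_smul, Matrix.smul_mul, Matrix.mul_smul, smul_smul]
  rw [mul_comm, mul_star_eq_one hc, one_smul]

theorem traceNorm_zero {ι : Type*} [Fintype ι] [DecidableEq ι] :
    traceNorm (0 : Matrix ι ι ℂ) = 0 := by
  rw [traceNorm]
  have h : (Matrix.isHermitian_conjTranspose_mul_self (0 : Matrix ι ι ℂ)).eigenvalues = 0 :=
    (Matrix.IsHermitian.eigenvalues_eq_zero_iff _).mpr (by simp)
  rw [h]
  simp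

theorem diamondDist_self {ι : Type*} [Fintype ι] [DecidableEq ι]
    (E : Matrix ι ι ℂ → Matrix ι ι ℂ) : diamondDist E E = 0 := by
  simp [diamondDist, traceNorm_zero]

theorem exists_layeredCircuit_diamondDist_eq_zero (C : Circuit (Fin m)) :
    ∃ D : LayeredCircuit m (compiledRounds m (twoQubitCount C) + 1),
      diamondDist (conjChannel (D.member 0)) (conjChannel (circuitOp C)) = 0 := by
  obtain ⟨D, c, hc, h⟩ := exists_layeredCircuit (circuitOp_mem C)
  exact ⟨D, by rw [h, conjChannel_smul hc, diamondDist_self]⟩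

theorem compiledRounds_le (m l : ℕ) (x : ℝ) (hx : 0 ≤ x) :
    ((compiledRounds m l + 1 : ℕ) : ℝ) ≤ (100000 : ℕ) * ((m : ℝ) + l + x + 1) ^ 2 := by
  -- The count is quadratic because a gate between distant qubits costs a number of rounds linear in
  -- `m`; `86528 = 2 * 416 * 104`.
  have h : compiledRounds m l + 1 = 86528 * (m * l) + 420 * l + 4 := by
    unfold compiledRounds gateRounds
    have : 2 * (((2 + 416 * m) * 104 + 2) * l + 2) = 86528 * (m * l) + 420 * l + 4 := by ring
    omega
  rw [h]
  push_cast
  have hm : (0 : ℝ) ≤ m := Nat.cast_nonneg m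
  have hl : (0 : ℝ) ≤ l := Nat.cast_nonneg l
  have h1 : ((m : ℝ) + l + 1) ^ 2 ≤ (m + l + x + 1) ^ 2 := by exact pow_le_pow_left₀ (by positivity) (by linarith) 2
  nlinarith [mul_nonneg hm hl, sq_nonneg (m : ℝ), sq_nonneg (l : ℝ)]

end Compile


/-! ### Input states -/

section States

variable {Q : Type*} [Fintype Q]

theorem ket0_eq_prod : (ket0 : Bits Q → ℂ) = fun b => ∏ q, if b q = 0 then 1 else 0 := by
  ext b
  rw [ket0]
  split_ifs with h
  · simp [h]
  · obtain ⟨q, hq⟩ := Function.ne_iff.mp h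
    exact (Finset.prod_eq_zero (Finset.mem_univ q) (if_neg hq)).symm

theorem inputState_eq_mulVec_ket0 [DecidableEq Q] (x : Bits Q) :
    inputState x = layer (fun q => if x q = 0 then hGate else 1) *ᵥ ket0 := by
  rw [ket0_eq_prod, layer_mulVec_prod _ fun _ i => if i = 0 then 1 else 0]
  ext b
  refine Finset.prod_congr rfl fun q _ => ?_
  split_ifs with h1 h2 <;>
    simp_all [Matrix.mulVec, dotProduct, hGate, Matrix.one_apply]
  rcases (by omega : b q = 0 ∨ b q = 1) with h | h <;> simp [h]

theorem norm_rzDiag (θ : ℝ) (b : Fin 2) : ‖rzDiag θ b‖ = 1 := by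
  have h (t : ℝ) : ‖Complex.exp (Complex.I * t)‖ = 1 := by
    rw [mul_comm]; exact Complex.norm_exp_ofReal_mul_I t
  unfold rzDiag
  split_ifs
  · have := h (-(θ / 2))
    rwa [show Complex.I * ((-(θ / 2) : ℝ) : ℂ) = -(Complex.I * θ / 2) by push_cast; ring] at this
  · have := h (θ / 2)
    rwa [show Complex.I * ((θ / 2 : ℝ) : ℂ) = Complex.I * θ / 2 by push_cast; ring] at this

/-- Diagonal phases just before a standard-basis measurement are invisible; this allows them to be
dropped or inserted there. -/
theorem norm_layer_rz_mulVec [DecidableEq Q] (θ : Q → ℝ) (ψ : Bits Q → ℂ) (b : Bits Q) :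
    ‖((layer fun q => rzGate (θ q)) *ᵥ ψ) b‖ = ‖ψ b‖ := by
  rw [layer_rz, Matrix.mulVec_diagonal, norm_mul, norm_prod]
  simp [norm_rzDiag]

theorem norm_czLayer_mulVec [DecidableEq Q] (G : SimpleGraph Q) (ψ : Bits Q → ℂ) (b : Bits Q) :
    ‖(czLayer G *ᵥ ψ) b‖ = ‖ψ b‖ := by
  rw [czLayer_eq_diagonal, Matrix.mulVec_diagonal, norm_mul, czPhase, norm_prod,
    Finset.prod_eq_one, one_mul]
  intro e _
  split_ifs <;> simp

theorem rzGate_mem_unitaryGroup (θ : ℝ) : rzGate θ ∈ Matrix.unitaryGroup (Fin 2) ℂ := by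
  rw [Matrix.mem_unitaryGroup_iff, Matrix.star_eq_conjTranspose, rzGate_eq_diagonal,
    Matrix.diagonal_conjTranspose, Matrix.diagonal_mul_diagonal, ← Matrix.diagonal_one]
  congr 1
  ext b
  exact mul_star_eq_one (norm_rzDiag θ b)

end States

/-! ### Depth of the preparation circuit -/

section Depth

variable {Q : Type*} [Fintype Q] [DecidableEq Q]

theorem circuitOp_append (c c' : Circuit Q) :
    circuitOp (c ++ c') = circuitOp c' * circuitOp c := by
  simp [circuitOp]

theorem circuitOp_map_one (l : List Q) (hl : l.Nodup) (U : Q → Matrix.unitaryGroup (Fin 2) ℂ) :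
    circuitOp (l.map fun q => Gate.one q (U q)) = layer fun q => if q ∈ l then (U q).1 else 1 := by
  induction l with
  | nil => simp [circuitOp, layer_one]
  | cons q l ih =>
    rw [List.nodup_cons] at hl
    rw [List.map_cons, circuitOp_cons, ih hl.2, op_one_eq_layer, layer_mul]
    congr 1
    ext1 s
    by_cases hs : s = q
    · subst hs
      simp [hl.1]
    · simp [hs]

/-- A parallel application of one-qubit gates. -/
noncomputable def oneQubitLayer (U : Q → Matrix.unitaryGroup (Fin 2) ℂ) : Circuit Q :=
  Finset.univ.toList.map fun q => Gate.one q (U q)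

theorem circuitOp_oneQubitLayer (U : Q → Matrix.unitaryGroup (Fin 2) ℂ) :
    circuitOp (oneQubitLayer U) = layer fun q => (U q).1 := by
  rw [oneQubitLayer, circuitOp_map_one _ (Finset.nodup_toList _)]
  simp

theorem pairwise_oneQubitLayer {R : Type*} [Fintype R] (U : R → Matrix.unitaryGroup (Fin 2) ℂ) :
    (oneQubitLayer U).Pairwise fun g g' => Disjoint g.support g'.support := by
  rw [oneQubitLayer, List.pairwise_map]
  exact (Finset.nodup_toList _).pairwise_of_forall_ne fun a _ b _ h => by
    simpa [Gate.support] using h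

theorem czGate_mem_unitaryGroup : czGate ∈ Matrix.unitaryGroup (Fin 2 × Fin 2) ℂ :=
  elementary_subset_unitaryGroup (Or.inl rfl)

/-- The `CZ` gate on an ordered edge of `G`. -/
noncomputable def edgeGate {Q : Type*} (G : SimpleGraph Q) (e : {e : Q × Q // G.Adj e.1 e.2}) :
    Gate Q :=
  Gate.two e.1.1 e.1.2 e.2.ne ⟨czGate, czGate_mem_unitaryGroup⟩

theorem circuitOp_map_edgeGate (G : SimpleGraph Q) (l : List {e : Q × Q // G.Adj e.1 e.2}) :
    circuitOp (l.map (edgeGate G)) =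
      Matrix.diagonal fun b => (l.map fun e => czSign (b e.1.1) (b e.1.2)).prod := by
  induction l with
  | nil => simp [circuitOp]
  | cons e l ih =>
    rw [List.map_cons, circuitOp_cons, ih, edgeGate, op_two_eq_embed, embed_czGate,
      Matrix.diagonal_mul_diagonal]
    congr 1
    ext b
    rw [List.map_cons, List.prod_cons, mul_comm]

variable {r m : ℕ}

open Classical in
/-- The edges of a graph on `Fin r × Fin m`, each oriented lexicographically. -/
noncomputable def orientedEdges (G : SimpleGraph (Fin r × Fin m)) :
    Finset {e : (Fin r × Fin m) × (Fin r × Fin m) // G.Adj e.1 e.2} :=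
  Finset.univ.filter fun e =>
    e.1.1.1 < e.1.2.1 ∨ e.1.1.1 = e.1.2.1 ∧ e.1.1.2 < e.1.2.2

theorem czPhase_eq_prod_orientedEdges (G : SimpleGraph (Fin r × Fin m)) (b : Bits (Fin r × Fin m)) :
    czPhase G b = ∏ e ∈ orientedEdges G, czSign (b e.1.1) (b e.1.2) := by
  classical
  rw [czPhase_eq_prod G ((orientedEdges G).image fun e => s(e.1.1, e.1.2)), Finset.prod_image]
  · exact Finset.prod_congr rfl fun e _ => prod_sign_mk b _ _
  · rintro ⟨⟨u, v⟩, h⟩ he ⟨⟨u', v'⟩, h'⟩ he' heq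
    simp only [orientedEdges, Finset.coe_filter, Finset.mem_univ, true_and, Set.mem_ofPred_eq]
      at he he'
    rcases Sym2.eq_iff.mp heq with ⟨h1, h2⟩ | ⟨h1, h2⟩
    · simp only at h1 h2
      subst h1 h2
      rfl
    · simp only at h1 h2
      subst h1 h2
      omega
  · intro e
    induction e using Sym2.ind with
    | _ u v =>
    simp only [Finset.mem_image, orientedEdges, Finset.mem_filter, Finset.mem_univ, true_and,
      SimpleGraph.mem_edgeSet]
    constructor
    · rintro ⟨e, -, he⟩
      have := e.2
      rwa [← SimpleGraph.mem_edgeSet, he, SimpleGraph.mem_edgeSet] at this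
    · intro h
      by_cases hlt : u.1 < v.1 ∨ u.1 = v.1 ∧ u.2 < v.2
      · exact ⟨⟨(u, v), h⟩, hlt, rfl⟩
      · refine ⟨⟨(v, u), h.symm⟩, ?_, Sym2.eq_swap⟩
        have hne : ¬(u.1 = v.1 ∧ u.2 = v.2) := fun hh => h.ne (Prod.ext hh.1 hh.2)
        simp only
        omega

/-- A proper colouring of the edges of a two-dimensional lattice. -/
def edgeColor (e : (Fin r × Fin m) × (Fin r × Fin m)) : Fin 4 :=
  if e.1.1 = e.2.1 then (if (e.1.2 : ℕ) % 2 = 0 then 0 else 1)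
  else (if (e.1.1 : ℕ) % 2 = 0 then 2 else 3)

/-- Edges of one colour are parallel, and their lower ends agree in parity along that direction, so
a shared vertex forces the two edges to coincide. -/
theorem disjoint_support_edgeGate {G : SimpleGraph (Fin r × Fin m)}
    (hG : G ≤ SimpleGraph.boxProd (SimpleGraph.pathGraph r) (SimpleGraph.pathGraph m))
    {e e' : {e : (Fin r × Fin m) × (Fin r × Fin m) // G.Adj e.1 e.2}}
    (he : e ∈ orientedEdges G) (he' : e' ∈ orientedEdges G) (hne : e ≠ e')
    (hc : edgeColor e.1 = edgeColor e'.1) :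
    Disjoint (edgeGate G e).support (edgeGate G e').support := by
  obtain ⟨⟨⟨a, b⟩, c, d⟩, h⟩ := e
  obtain ⟨⟨⟨a', b'⟩, c', d'⟩, h'⟩ := e'
  have hb := hG h
  have hb' := hG h'
  simp only [SimpleGraph.boxProd_adj, SimpleGraph.pathGraph_adj, Fin.ext_iff] at hb hb'
  simp only [orientedEdges, Finset.mem_filter, Finset.mem_univ, true_and, Fin.lt_def,
    Fin.ext_iff] at he he'
  have hne' : ¬((a : ℕ) = a' ∧ (b : ℕ) = b' ∧ (c : ℕ) = c' ∧ (d : ℕ) = d') := by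
    rintro ⟨h1, h2, h3, h4⟩
    exact hne (Subtype.ext (Prod.ext (Prod.ext (Fin.ext h1) (Fin.ext h2))
      (Prod.ext (Fin.ext h3) (Fin.ext h4))))
  simp only [edgeColor, Fin.ext_iff (n := r)] at hc
  rw [Set.disjoint_left]
  simp only [edgeGate, Gate.support, Set.mem_insert_iff, Set.mem_singleton_iff]
  split_ifs at hc <;> simp at hc <;>
  · rintro ⟨s, t⟩ h1 h2
    simp only [Prod.mk.injEq, Fin.ext_iff] at h1 h2
    omega

theorem qnnState_hasDepthAtMost {G : SimpleGraph (Fin r × Fin m)}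
    (hG : G ≤ SimpleGraph.boxProd (SimpleGraph.pathGraph r) (SimpleGraph.pathGraph m))
    (θ : Fin r × Fin m → ℝ) (x : Bits (Fin r × Fin m)) :
    ∃ c : Circuit (Fin r × Fin m), HasDepthAtMost c 7 ∧ circuitOp c *ᵥ ket0 = qnnState G θ x := by
  -- State preparation and rotation share one layer; with four `CZ` layers and the closing Hadamards
  -- this makes six layers, within the bound.
  let U₀ : Fin r × Fin m → Matrix.unitaryGroup (Fin 2) ℂ := fun v =>
    ⟨rzGate (θ v) * (if x v = 0 then hGate else 1), mul_mem (rzGate_mem_unitaryGroup _) (by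
      split_ifs
      exacts [hGate_mem_unitaryGroup, one_mem _])⟩
  let U₁ : Fin r × Fin m → Matrix.unitaryGroup (Fin 2) ℂ := fun _ => ⟨hGate, hGate_mem_unitaryGroup⟩
  let E (i : Fin 4) := ((orientedEdges G).filter fun e => edgeColor e.1 = i).toList
  let czs : List (List (Gate (Fin r × Fin m))) := List.ofFn fun i => (E i).map (edgeGate G)
  have hcz : circuitOp czs.flatten = czLayer G := by
    have h1 : czs.flatten = (List.ofFn E).flatten.map (edgeGate G) := by
      rw [List.map_flatten, List.map_ofFn]; rfl
    rw [h1, circuitOp_map_edgeGate, czLayer_eq_diagonal]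
    congr 1
    ext b
    rw [czPhase_eq_prod_orientedEdges, List.map_flatten, List.prod_flatten, List.map_ofFn,
      List.map_ofFn, List.prod_ofFn, ← Finset.prod_fiberwise (orientedEdges G) fun e => edgeColor e.1]
    exact Finset.prod_congr rfl fun i _ => Finset.prod_map_toList _ _
  refine ⟨(oneQubitLayer U₀ :: (czs ++ [oneQubitLayer U₁])).flatten,
    ⟨_, rfl, by simp [czs], ?_⟩, ?_⟩
  · intro l hl
    simp only [List.mem_cons, List.mem_append, List.not_mem_nil, or_false] at hl
    rcases hl with rfl | hl | rfl
    · exact pairwise_oneQubitLayer _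
    · obtain ⟨i, rfl⟩ := (List.mem_ofFn' _ _).mp hl
      rw [List.pairwise_map]
      refine (Finset.nodup_toList _).pairwise_of_forall_ne fun e he e' he' hne => ?_
      rw [Finset.mem_toList, Finset.mem_filter] at he he'
      exact disjoint_support_edgeGate hG he.1 he'.1 hne (he.2.trans he'.2.symm)
    · exact pairwise_oneQubitLayer _
  · rw [List.flatten_cons, List.flatten_append, List.flatten_singleton, circuitOp_append,
      circuitOp_append, hcz, circuitOp_oneQubitLayer, circuitOp_oneQubitLayer, qnnState,
      inputState_eq_mulVec_ket0, Matrix.mulVec_mulVec, Matrix.mul_assoc _ (layer _) (layer _),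
      layer_mul]

end Depth

/-! ### Sampling from the family of a 1D circuit -/

section Sampling

variable {m k : ℕ}

/-- The geometry of the IDQNN that samples from the family of `D`. -/
def samplingGraph (D : LayeredCircuit m (k + 1)) : SimpleGraph (Fin (k + 1) × Fin m) where
  Adj u v := (SimpleGraph.pathGraph (k + 1)).Adj u.1 v.1 ∧ u.2 = v.2 ∨
    u.1 = v.1 ∧ u.1 ≠ Fin.last k ∧ (D.cz u.1).Adj u.2 v.2
  symm := ⟨by
    rintro u v (⟨h1, h2⟩ | ⟨h1, h2, h3⟩)
    · exact Or.inl ⟨h1.symm, h2.symm⟩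
    · exact Or.inr ⟨h1.symm, h1 ▸ h2, h1 ▸ h3.symm⟩⟩
  loopless := ⟨by rintro u (⟨h, -⟩ | ⟨-, -, h⟩) <;> exact h.ne rfl⟩

/-- The angles of the IDQNN that samples from the family of `D`. -/
noncomputable def samplingAngle (D : LayeredCircuit m (k + 1)) (v : Fin (k + 1) × Fin m) : ℝ :=
  if v.1 = Fin.last k then Real.pi / 2
  else D.angle v.1 v.2 + if (v.1 : ℕ) + 1 = k then Real.pi / 2 else 0

theorem isSlicedLattice_samplingGraph (D : LayeredCircuit m (k + 1)) :
    IsSlicedLattice (SimpleGraph.pathGraph m) (samplingGraph D) := by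
  refine ⟨?_, fun j j' s h => Or.inl ⟨h, rfl⟩⟩
  rintro u v (h | ⟨h1, -, h3⟩)
  · exact Or.inl h
  · exact Or.inr ⟨D.cz_le _ h3, h1⟩

theorem comap_samplingGraph_castSucc (D : LayeredCircuit m (k + 1)) (j : Fin k) :
    ((samplingGraph D).comap fun s => (j.castSucc, s)) = D.cz j.castSucc := by
  ext s t
  simp [samplingGraph, (Fin.castSucc_lt_last j).ne]

theorem comap_samplingGraph_last (D : LayeredCircuit m (k + 1)) :
    ((samplingGraph D).comap fun s => (Fin.last k, s)) = ⊥ := by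
  ext s t
  simp [samplingGraph]

theorem rzGate_add (α β : ℝ) : rzGate (α + β) = rzGate α * rzGate β := by
  simp only [rzGate_eq_diagonal, Matrix.diagonal_mul_diagonal]
  congr 1
  ext b
  unfold rzDiag
  split_ifs <;> rw [← Complex.exp_add] <;> push_cast <;> ring_nf

theorem rzGate_pi_div_two : rzGate (Real.pi / 2) =
    ((Real.sqrt 2 : ℝ) : ℂ)⁻¹ • !![1 - Complex.I, 0; 0, 1 + Complex.I] := by
  have hs : ((Real.sqrt 2 / 2 : ℝ) : ℂ) = ((Real.sqrt 2 : ℝ) : ℂ)⁻¹ := by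
    rw [← Complex.ofReal_inv]
    congr 1
    rw [Real.sqrt_div_self', one_div]
  have h1 : Complex.exp (Complex.I * ((Real.pi / 2 : ℝ) : ℂ) / 2) =
      ((Real.sqrt 2 : ℝ) : ℂ)⁻¹ * (1 + Complex.I) := by
    rw [show Complex.I * ((Real.pi / 2 : ℝ) : ℂ) / 2 = ((Real.pi / 4 : ℝ) : ℂ) * Complex.I by
      push_cast; ring, Complex.exp_mul_I, ← Complex.ofReal_cos, ← Complex.ofReal_sin,
      Real.cos_pi_div_four, Real.sin_pi_div_four, hs]
    ring
  have h2 : Complex.exp (-(Complex.I * ((Real.pi / 2 : ℝ) : ℂ) / 2)) =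
      ((Real.sqrt 2 : ℝ) : ℂ)⁻¹ * (1 - Complex.I) := by
    rw [show -(Complex.I * ((Real.pi / 2 : ℝ) : ℂ) / 2) = ((-(Real.pi / 4) : ℝ) : ℂ) * Complex.I by
      push_cast; ring, Complex.exp_mul_I, ← Complex.ofReal_cos, ← Complex.ofReal_sin,
      Real.cos_neg, Real.sin_neg, Real.cos_pi_div_four, Real.sin_pi_div_four, Complex.ofReal_neg, hs]
    ring
  rw [rzGate, h1, h2]
  ext i j
  fin_cases i <;> fin_cases j <;> simp

/-- A Hadamard gate written with two Hadamard gates and rotations. -/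
theorem rz_h_rz_h_rz : rzGate (Real.pi / 2) *
    (hGate * (rzGate (Real.pi / 2) * (hGate * rzGate (Real.pi / 2)))) = (-Complex.I) • hGate := by
  rw [show rzGate (Real.pi / 2) * (hGate * (rzGate (Real.pi / 2) *
    (hGate * rzGate (Real.pi / 2)))) = rzGate (Real.pi / 2) * (hGate * rzGate (Real.pi / 2) *
      hGate) * rzGate (Real.pi / 2) by simp only [Matrix.mul_assoc], hGate_mul_mul_hGate,
    rzGate_pi_div_two, hGate]
  simp only [Matrix.smul_mul, Matrix.mul_smul, smul_smul]
  have h := sqrt_two_inv_mul_self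
  generalize ((Real.sqrt 2 : ℝ) : ℂ)⁻¹ = s at h ⊢
  rw [show s * (2⁻¹ * s * s) = s * (2⁻¹ * 2⁻¹) by rw [mul_assoc 2⁻¹, h]]
  have h3 := Complex.I_sq
  ext i j
  fin_cases i <;> fin_cases j <;> simp <;> ring_nf <;> simp [h3] <;> ring_nf

/-- With `A` the Hadamard layer, this moves the Hadamards from the end of each step of the deep
process to the start of each round of `D`. -/
theorem timeOrdered_mul_shift {Q : Type*} [Fintype Q] [DecidableEq Q] (A : Op Q)
    (M : Fin k → Op Q) :
    (timeOrdered fun j => A * M j) * A = A * timeOrdered fun j => M j * A := by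
  induction k with
  | zero => simp [timeOrdered_zero]
  | succ k ih =>
    rw [timeOrdered_succ_last, Matrix.mul_assoc, ih, timeOrdered_succ_last]
    simp only [Matrix.mul_assoc]

theorem zGate_pow_eq_diagonal (n : ℕ) : zGate ^ n = Matrix.diagonal (![1, (-1) ^ n]) := by
  have : zGate = Matrix.diagonal ![1, -1] := by
    ext i j
    fin_cases i <;> fin_cases j <;> simp [zGate]
  rw [this, Matrix.diagonal_pow]
  congr 1
  ext i
  fin_cases i <;> simp

theorem mul_shift_of_commute {M : Type*} [Semigroup M] (s z c r h : M) (hz : Commute s z)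
    (hc : Commute s c) (hr : Commute s r) : z * (c * (r * s)) * h = s * (z * (c * r * h)) := by
  rw [← hr.eq, hc.symm.left_comm, hz.symm.left_comm]
  simp only [mul_assoc]

/-- The shifted angle in the last but one slice amounts to a rotation after the first `k` rounds. -/
theorem exists_timeOrdered_sliceOp_mulVec (D : LayeredCircuit m (k + 1))
    (y' : Bits (Fin k × Fin m)) : ∃ c : ℂ, ‖c‖ = 1 ∧
      (timeOrdered fun j : Fin k => layer (fun i => zGate ^ (y' (j, i) : ℕ)) *
        sliceOp (samplingGraph D) (samplingAngle D) j.castSucc * layer fun _ => hGate) *ᵥ ket0 =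
      c • ((layer fun _ => rzGate (Real.pi / 2)) *ᵥ ((timeOrdered fun j : Fin k =>
        layer (fun i => zGate ^ (y' (j, i) : ℕ)) * D.round j.castSucc) *ᵥ ket0)) := by
  have hslice (j : Fin k) : sliceOp (samplingGraph D) (samplingAngle D) j.castSucc =
      czLayer (D.cz j.castSucc) * layer fun i => rzGate (samplingAngle D (j.castSucc, i)) := by
    rw [sliceOp, comap_samplingGraph_castSucc]
  cases k with
  | zero =>
    -- Here no slice precedes the last one to hold the extra rotation, but on `|0…0⟩` that rotation
    -- is only a global phase.
    refine ⟨(∏ _i : Fin m, rzDiag (Real.pi / 2) 0)⁻¹, by simp [norm_rzDiag], ?_⟩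
    have h0 : rzDiag (Real.pi / 2) 0 ≠ 0 := by rw [← norm_ne_zero_iff, norm_rzDiag]; exact one_ne_zero
    rw [timeOrdered_zero, timeOrdered_zero, Matrix.one_mulVec, layer_rz]
    ext b
    rw [Pi.smul_apply, Matrix.mulVec_diagonal, ket0, smul_eq_mul]
    split_ifs with hb
    · simp [hb, h0]
    · simp
  | succ k =>
    refine ⟨1, norm_one, ?_⟩
    rw [one_smul, Matrix.mulVec_mulVec, timeOrdered_succ_last, timeOrdered_succ_last,
      ← Matrix.mul_assoc]
    congr 2
    -- Only this slice carries the extra `π / 2`; being diagonal, it commutes to the left past the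
    -- rotations, the `CZ` gates and the random `Z` gates.
    · rw [hslice, LayeredCircuit.round]
      have : (fun i => rzGate (samplingAngle D ((Fin.last k).castSucc, i))) =
          fun i => rzGate (D.angle (Fin.last k).castSucc i + Real.pi / 2) := by
        ext1 i
        simp [samplingAngle, (Fin.castSucc_lt_last (Fin.last k)).ne]
      rw [this]
      simp only [rzGate_add, ← layer_mul]
      refine mul_shift_of_commute _ _ _ _ _ ?_ ?_ ?_
      · simp only [zGate_pow_eq_diagonal]
        rw [layer_diagonal, layer_rz]
        exact Matrix.commute_diagonal _ _
      · rw [czLayer_eq_diagonal, layer_rz]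
        exact Matrix.commute_diagonal _ _
      · rw [layer_rz, layer_rz]
        exact Matrix.commute_diagonal _ _
    · congr 1
      ext1 j
      rw [hslice, LayeredCircuit.round]
      have : (fun i => rzGate (samplingAngle D (j.castSucc.castSucc, i))) =
          fun i => rzGate (D.angle j.castSucc.castSucc i) := by
        ext1 i
        simp [samplingAngle, (Fin.castSucc_lt_last j.castSucc).ne, j.isLt.ne]
      rw [this]
      simp only [Matrix.mul_assoc]

/-- Each of the `k` transfers contributes an amplitude `1/√2` per qubit, which gives the uniform
weight on `y'`; the rest is the amplitude of `D(y')` up to phases. -/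
theorem qnnProb_sampling (D : LayeredCircuit m (k + 1)) (y : Bits (Fin (k + 1) × Fin m)) :
    qnnProb (samplingGraph D) (samplingAngle D) 0 y = (1 / 2 : ℝ) ^ (k * m) *
      D.memberProb (fun p => y (p.1.castSucc, p.2)) (fun i => y (Fin.last k, i)) := by
  set s : ℂ := ((Real.sqrt 2 : ℝ) : ℂ)⁻¹ with hs
  set z : Bits (Fin m) := fun i => y (Fin.last k, i)
  set S : Op (Fin m) := layer fun _ => rzGate (Real.pi / 2) with hS
  set H : Op (Fin m) := layer fun _ => hGate with hH
  set T : Op (Fin m) := timeOrdered fun j : Fin k =>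
    layer (fun i => zGate ^ (y (j.castSucc, i) : ℕ)) * D.round j.castSucc with hT
  have hmember : D.memberProb (fun p => y (p.1.castSucc, p.2)) z =
      ‖(H *ᵥ (T *ᵥ ket0)) z‖ ^ 2 := by
    rw [LayeredCircuit.memberProb, LayeredCircuit.member, ← Matrix.mulVec_mulVec,
      LayeredCircuit.round, ← Matrix.mulVec_mulVec, ← Matrix.mulVec_mulVec, norm_czLayer_mulVec,
      norm_layer_rz_mulVec]
  have hlast : sliceOp (samplingGraph D) (samplingAngle D) (Fin.last k) = S := by
    rw [sliceOp, comap_samplingGraph_last, czLayer_bot, Matrix.one_mul]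
    simp [samplingAngle, hS]
  have hinput : inputState (fun i : Fin m => (0 : Bits (Fin (k + 1) × Fin m)) (0, i)) =
      H *ᵥ ket0 := by
    rw [inputState_eq_mulVec_ket0]
    simp [hH]
  have htransfer (j : Fin k) : (layer fun i => transfer
      ((0 : Bits (Fin (k + 1) × Fin m)) (j.succ, i)) (y (j.castSucc, i))) =
      s ^ m • (H * layer fun i => zGate ^ (y (j.castSucc, i) : ℕ)) := by
    simp only [transfer, Pi.zero_apply, if_true]
    rw [layer_smul (fun _ => s), layer_mul]
    simp
  obtain ⟨c, hc, hshift⟩ := exists_timeOrdered_sliceOp_mulVec D fun p => y (p.1.castSucc, p.2)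
  have hshs : S * (H * (S * (H * S))) = (-Complex.I) ^ m • H := by
    rw [hS, hH]
    simp only [layer_mul, rz_h_rz_h_rz]
    rw [layer_smul fun _ => -Complex.I]
    simp
  have hamp : deepAmp (samplingGraph D) (samplingAngle D) 0 y =
      (s ^ m) ^ k * (c * ((H * (S * (H * S))) *ᵥ (T *ᵥ ket0)) z) := by
    rw [deepAmp, hinput, hlast]
    simp only [htransfer, Matrix.smul_mul]
    rw [timeOrdered_smul, Matrix.mul_smul, Matrix.smul_mulVec, Matrix.mulVec_mulVec]
    simp only [Matrix.mul_assoc]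
    rw [timeOrdered_mul_shift]
    simp only [← Matrix.mul_assoc]
    rw [← Matrix.mulVec_mulVec, hshift, Matrix.mulVec_smul, Matrix.mulVec_mulVec]
    simp [Matrix.mul_assoc, z, hH, hS, hT]
  -- An additional `S` on the left does not change the modulus and completes the word `S H S H S`, a
  -- phase times `H`.
  have hnorm : ‖((H * (S * (H * S))) *ᵥ (T *ᵥ ket0)) z‖ = ‖(H *ᵥ (T *ᵥ ket0)) z‖ := by
    rw [← norm_layer_rz_mulVec (fun _ => Real.pi / 2), ← hS, Matrix.mulVec_mulVec, hshs,
      Matrix.smul_mulVec]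
    simp
  have hsn : ‖s‖ ^ 2 = 1 / 2 := by
    rw [← Complex.normSq_eq_norm_sq, hs, ← Complex.ofReal_inv, Complex.normSq_ofReal, ← mul_inv,
      Real.mul_self_sqrt (by norm_num)]
    norm_num
  rw [qnnProb, qnnState_eq_deepAmp (isSlicedLattice_samplingGraph D), hamp, hmember, norm_mul,
    norm_mul, hc, one_mul, hnorm, norm_pow, norm_pow, mul_pow, ← pow_mul, ← pow_mul,
    show m * (k * 2) = 2 * (k * m) by ring, pow_mul, hsn]

end Sampling

end IDQNN

theorem mainTheorem8 :
    -- the shallow-to-deep equivalence on a `(d + 1)`-dimensional lattice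
    (∀ (d : ℕ) (_ : 1 ≤ d) (n : Fin d → ℕ) (k : ℕ)
      (G : SimpleGraph (Fin (k + 1) × ((j : Fin d) → Fin (n j)))),
      IsSlicedLattice (latticeGraph n) G →
      ∀ (θ : Fin (k + 1) × ((j : Fin d) → Fin (n j)) → ℝ)
        (x y : Bits (Fin (k + 1) × ((j : Fin d) → Fin (n j)))),
        qnnProb G θ x y = deepProb G θ x y) ∧
    -- the number of rounds is `r = k + 1`, bounded by a polynomial in `m`, `ℓ`, `log (1 / ε)`
    (∃ (k : ℕ → ℕ → ℝ → ℕ) (a b : ℕ),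
      (∀ (m ℓ : ℕ) (ε : ℝ), 0 < ε →
        ((k m ℓ ε + 1 : ℕ) : ℝ) ≤ a * (m + ℓ + max 0 (Real.log (1 / ε)) + 1) ^ b) ∧
      ∀ (m ℓ : ℕ) (ε : ℝ), 0 < ε → ∀ C : Circuit (Fin m), twoQubitCount C = ℓ →
        -- there is a deep 1D circuit whose family contains an `ε`-approximation of `C`
        (∃ D : LayeredCircuit m (k m ℓ ε + 1),
          diamondDist (conjChannel (D.member 0)) (conjChannel (circuitOp C)) ≤
            ENNReal.ofReal ε) ∧
        -- and every such family is sampled by an instantaneously-deep QNN on the 2D lattice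
        ∀ D : LayeredCircuit m (k m ℓ ε + 1),
          diamondDist (conjChannel (D.member 0)) (conjChannel (circuitOp C)) ≤
            ENNReal.ofReal ε →
          ∃ (G : SimpleGraph (Fin (k m ℓ ε + 1) × Fin m)) (θ : Fin (k m ℓ ε + 1) × Fin m → ℝ),
            IsSlicedLattice (SimpleGraph.pathGraph m) G ∧
            -- constant depth of the QNN
            (∀ x, ∃ c : Circuit (Fin (k m ℓ ε + 1) × Fin m),
              HasDepthAtMost c 7 ∧ circuitOp c *ᵥ ket0 = qnnState G θ x) ∧
            -- output distribution on the all-zero input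
            ∀ y : Bits (Fin (k m ℓ ε + 1) × Fin m),
              qnnProb G θ 0 y =
                (1 / 2 : ℝ) ^ (k m ℓ ε * m) *
                  D.memberProb (fun p => y (p.1.castSucc, p.2))
                    (fun i => y (Fin.last (k m ℓ ε), i))) := by
  refine ⟨fun d _ n k G hG θ x y => qnnProb_eq_deepProb hG θ x y,
    -- The compilation is exact, so one number of rounds serves every precision.
    fun m l _ => compiledRounds m l, 100000, 2,
    fun m l ε _ => compiledRounds_le m l _ (le_max_left _ _), ?_⟩
  rintro m l ε - C rfl
  refine ⟨?_, fun D _ => ⟨samplingGraph D, samplingAngle D, isSlicedLattice_samplingGraph D,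
    fun x => qnnState_hasDepthAtMost (isSlicedLattice_samplingGraph D).1 _ x,
    qnnProb_sampling D⟩⟩
  obtain ⟨D, hD⟩ := exists_layeredCircuit_diamondDist_eq_zero C
  exact ⟨D, hD.trans_le zero_le⟩
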